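/- Let $\mathsf M$ be a smooth manifold of dimension $n\ge 1$ and let $F_s(x,p)=\sum_{i,j}h_s^{ij}(x)p_ip_j$, $s=1,\dots,n$, be functions on $T^*\mathsf M$ given by smooth symmetric contravariant $2$-tensor fields $h_s$. Assume: (i) the $F_s$ pairwise commute with respect to the canonical Poisson bracket on $T^*\mathsf M$; (ii) at every $x\in\mathsf M$, $\det(\partial F/\partial p)\neq 0$ for generic $p\in T_x^*\mathsf M$; (iii) $h_1$ is nondegenerate at every point, and the Killing tensors $K_s=h_sh_1^{-1}$ commute as operators: $K_iK_j=K_jK_i$. Notation. For operator fields $L,N$ put $\langle L,N\rangle(\xi,\eta)=LN[\xi,\eta]+[L\xi,N\eta]-L[\xi,N\eta]-N[L\xi,\eta]$. $L$ is Nijenhuis if $\langle L,L\rangle=0$; $L$ and $N$ are strong symmetries of each other if $LN=NL$ and $\langle L,N\rangle=0$. For operator fields $B^1,\dots,B^n$ on an open set $U$, $\mathsf{Sym}(B^1,\dots,B^n)$ is the set of smooth operator fields on $U$ that are strong symmetries of all $B^i$. We say that $B^1,\dots,B^n$ generate a symmetry algebra on $U$ if they are smooth, are pairwise strong symmetries of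 each other (also of themselves) and, at each point of $U$, $B^1\xi,\dots,B^n\xi$ are linearly independent for some tangent vector $\xi$ and $B^{1*}a,\dots,B^{n*}a$ are linearly independent for some covector $a$. A regular common level over an open set $U\subset\mathsf M$ is a smooth $1$-form $\alpha$ on $U$ such that every $F_s(x,\alpha(x))$ is constant on $U$ and the vectors $\xi_s=\partial F_s/\partial p\,|_{p=\alpha}=2h_s(\alpha,\cdot)$, $s=1,\dots,n$, are linearly independent at each point of $U$. To it one attaches, with the metric $g=h_1^{-1}$ and the matrix $b_{ij}=g(\xi_i,\xi_j)$ (which is invertible), the operator fields $M^i=\sum_s b^{is}K_s$ on $U$, where $(b^{is})=(b_{is})^{-1}$, i.e. the operators dual to the $K_s$ with respect to the form $b(K_i,K_j)=b_{ij}$. Then every point of $\mathsf M$ has a neighbourhood over which a regular common level exists. The operators $K_1,\dots,K_n$ are linearly independent at each point, and there are (hence unique) smooth functions $a_{ij}^s$ on $\mathsf M$ with $K_iK_j=\sum_s a_{ij}^sK_s$. Moreover, let $a_1,\dots,a_n\in\mathbb R$ be constants and $U\subset\mathsf M$ an open set such that the form $\bar b_{ij}=\sum_s a_{ij}^sa_s$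 is nondegenerate at each point of $U$, and let $\bar M^i=\sum_s\bar b^{is}K_s$, with $(\bar b^{is})=(\bar b_{is})^{-1}$, be the operators dual to the $K_s$ with respect to $\bar b$. Then on $U$ the operators $\bar M^1,\dots,\bar M^n$ are Nijenhuis and generate a symmetry algebra. For every regular common level over $U$, the attached operators $M^1,\dots,M^n$ generate a symmetry algebra on $U$, the operator $a_1M^1+\dots+a_nM^n$ is invertible at each point of $U$, and $$\bar M^i=(a_1M^1+\dots+a_nM^n)^{-1}M^i,\qquad i=1,\dots,n.$$ Furthermore $\mathsf{Sym}(\bar M^1,\dots,\bar M^n)=\mathsf{Sym}(M^1,\dots,M^n)$, and $\bar M^1,\dots,\bar M^n$ form a basis of this algebra: they belong to it, are linearly independent at each point of $U$, and every element of it is $\sum_i g_i\bar M^i$ with smooth functions $g_i$ on $U$. -/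

import Mathlib

open scoped Manifold ContDiff

noncomputable section

namespace OperatorFrobenius

/-! Tensor fields on a smooth `n`-dimensional manifold `M` without boundary.  Pointwise objects live
on Mathlib's tangent spaces; smoothness is smoothness of all components in all smooth charts. -/

section Basic

variable {n : ℕ} {M : Type*} [TopologicalSpace M] [ChartedSpace (EuclideanSpace ℝ (Fin n)) M]

/-- The cotangent space at `x`. -/
abbrev Cotangent (n : ℕ) {M : Type*} [TopologicalSpace M]
    [ChartedSpace (EuclideanSpace ℝ (Fin n)) M] (x : M) : Type :=
  Module.Dual ℝ (TangentSpace (𝓡 n) x)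

/-- Families of endomorphisms of the tangent spaces, i.e. (not yet smooth) operator fields. -/
abbrev OpField (n : ℕ) (M : Type*) [TopologicalSpace M]
    [ChartedSpace (EuclideanSpace ℝ (Fin n)) M] : Type _ :=
  ∀ x : M, Module.End ℝ (TangentSpace (𝓡 n) x)

/-- Families of covectors, i.e. (not yet smooth) differential 1-forms. -/
abbrev OneForm (n : ℕ) (M : Type*) [TopologicalSpace M]
    [ChartedSpace (EuclideanSpace ℝ (Fin n)) M] : Type _ :=
  ∀ x : M, Cotangent n x

/-- Families of contravariant 2-tensors, a tensor `h^{ij}` being regarded as the linear map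
`p_j ↦ h^{ij} p_j` from covectors to vectors; the bilinear form on covectors is
`(p, q) ↦ p (h q)`. -/
abbrev CoTensor (n : ℕ) (M : Type*) [TopologicalSpace M]
    [ChartedSpace (EuclideanSpace ℝ (Fin n)) M] : Type _ :=
  ∀ x : M, Cotangent n x →ₗ[ℝ] TangentSpace (𝓡 n) x

/-- The covector `du^i` at `x`, where `u^1, …, u^n` are the coordinates of the chart `φ`. -/
def coordCovector (φ : OpenPartialHomeomorph M (EuclideanSpace ℝ (Fin n))) (x : M) (i : Fin n) :
    Cotangent n x :=
  (EuclideanSpace.proj i : EuclideanSpace ℝ (Fin n) →L[ℝ] ℝ).toLinearMap ∘ₗ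
    (mvfderiv (𝓡 n) φ x).toLinearMap

/-- The coordinate vector `∂/∂u^i` at the point of `M` with coordinates `y` in the chart `φ`. -/
def coordVector (φ : OpenPartialHomeomorph M (EuclideanSpace ℝ (Fin n)))
    (y : EuclideanSpace ℝ (Fin n)) (i : Fin n) : TangentSpace (𝓡 n) (φ.symm y) :=
  mfderiv (𝓡 n) (𝓡 n) φ.symm y
    ((NormedSpace.fromTangentSpace y).symm (EuclideanSpace.single i (1 : ℝ)))

/-- The operator field `L` is smooth on `U`: its components `L^i_j` are. -/
def SmoothOpOn (U : Set M) (L : OpField n M) : Prop :=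
  ∀ φ ∈ IsManifold.maximalAtlas (𝓡 n) ∞ M, ∀ i j : Fin n,
    ContDiffOn ℝ ∞
      (fun y => coordCovector φ (φ.symm y) i (L (φ.symm y) (coordVector φ y j)))
      (φ.target ∩ φ.symm ⁻¹' U)

/-- The 1-form `α` is smooth on `U`: its components `α_j` are. -/
def SmoothFormOn (U : Set M) (α : OneForm n M) : Prop :=
  ∀ φ ∈ IsManifold.maximalAtlas (𝓡 n) ∞ M, ∀ j : Fin n,
    ContDiffOn ℝ ∞ (fun y => α (φ.symm y) (coordVector φ y j)) (φ.target ∩ φ.symm ⁻¹' U)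

/-- The contravariant 2-tensor field `h` is smooth: its components `h^{ij}` are. -/
def SmoothCoTensor (h : CoTensor n M) : Prop :=
  ∀ φ ∈ IsManifold.maximalAtlas (𝓡 n) ∞ M, ∀ i j : Fin n,
    ContDiffOn ℝ ∞
      (fun y => coordCovector φ (φ.symm y) i (h (φ.symm y) (coordCovector φ (φ.symm y) j)))
      φ.target

/-- Symmetry `h^{ij} = h^{ji}`. -/
def SymmCoTensor (h : CoTensor n M) : Prop :=
  ∀ (x : M) (p q : Cotangent n x), p (h x q) = q (h x p)

end Basic

section Poisson

variable {n : ℕ} {M : Type*} [TopologicalSpace M] [ChartedSpace (EuclideanSpace ℝ (Fin n)) M]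

/-- The function `F(x, p) = h^{ij}(x) p_i p_j` on the cotangent bundle. -/
def quadFun (h : CoTensor n M) (x : M) (p : Cotangent n x) : ℝ := p (h x p)

/-- A function on the cotangent bundle written in the canonical coordinates
`(u^1, …, u^n, p_1, …, p_n)` that belong to the chart `φ`. -/
def inCoords (φ : OpenPartialHomeomorph M (EuclideanSpace ℝ (Fin n)))
    (F : ∀ x : M, Cotangent n x → ℝ) (z : EuclideanSpace ℝ (Fin n) × (Fin n → ℝ)) : ℝ :=
  F (φ.symm z.1) (∑ i, z.2 i • coordCovector φ (φ.symm z.1) i)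

/-- `∂f/∂u^i` of a function of `(u, p)`. -/
def partialU (f : EuclideanSpace ℝ (Fin n) × (Fin n → ℝ) → ℝ) (i : Fin n)
    (z : EuclideanSpace ℝ (Fin n) × (Fin n → ℝ)) : ℝ :=
  fderiv ℝ f z (EuclideanSpace.single i (1 : ℝ), 0)

/-- `∂f/∂p_i` of a function of `(u, p)`. -/
def partialP (f : EuclideanSpace ℝ (Fin n) × (Fin n → ℝ) → ℝ) (i : Fin n)
    (z : EuclideanSpace ℝ (Fin n) × (Fin n → ℝ)) : ℝ :=
  fderiv ℝ f z (0, Pi.single i (1 : ℝ))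

/-- `F` and `G` commute with respect to the canonical Poisson bracket of the cotangent bundle,
`{F, G} = ∑ᵢ (∂F/∂p_i ∂G/∂u^i - ∂F/∂u^i ∂G/∂p_i)` in canonical coordinates. -/
def PoissonCommute (F G : ∀ x : M, Cotangent n x → ℝ) : Prop :=
  ∀ φ ∈ IsManifold.maximalAtlas (𝓡 n) ∞ M, ∀ y ∈ φ.target, ∀ p : Fin n → ℝ,
    ∑ i, (partialP (inCoords φ F) i (y, p) * partialU (inCoords φ G) i (y, p) -
      partialU (inCoords φ F) i (y, p) * partialP (inCoords φ G) i (y, p)) = 0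

/-- At every point `x`, `det (∂F_s/∂p_j) ≠ 0` for generic `p ∈ T*_x M`.  (The determinant is a
polynomial in `p`, so the set in question is automatically open.) -/
def GenericallyIndependent (F : Fin n → ∀ x : M, Cotangent n x → ℝ) : Prop :=
  ∀ φ ∈ IsManifold.maximalAtlas (𝓡 n) ∞ M, ∀ y ∈ φ.target,
    Dense {p : Fin n → ℝ |
      (Matrix.of fun s j => partialP (inCoords φ (F s)) j (y, p)).det ≠ 0}

end Poisson

section Symmetries

variable {n : ℕ} {M : Type*} [TopologicalSpace M] [ChartedSpace (EuclideanSpace ℝ (Fin n)) M]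
  [IsManifold (𝓡 n) ∞ M]

/-- The vector field `ξ` is smooth on `U`. -/
def SmoothVecOn (U : Set M) (ξ : ∀ x : M, TangentSpace (𝓡 n) x) : Prop :=
  ContMDiffOn (𝓡 n) (𝓡 n).tangent ∞ (fun x => (⟨x, ξ x⟩ : TangentBundle (𝓡 n) M)) U

/-- `⟨L, N⟩(ξ, η) = LN[ξ, η] + [Lξ, Nη] - L[ξ, Nη] - N[Lξ, η]` at the point `x`. -/
def opBracket (L N : OpField n M) (ξ η : ∀ x : M, TangentSpace (𝓡 n) x) (x : M) :
    TangentSpace (𝓡 n) x :=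
  L x (N x (VectorField.mlieBracket (𝓡 n) ξ η x)) +
      VectorField.mlieBracket (𝓡 n) (fun z => L z (ξ z)) (fun z => N z (η z)) x -
    L x (VectorField.mlieBracket (𝓡 n) ξ (fun z => N z (η z)) x) -
    N x (VectorField.mlieBracket (𝓡 n) (fun z => L z (ξ z)) η x)

/-- `⟨L, N⟩ = 0` on `U`. -/
def BracketVanishesOn (U : Set M) (L N : OpField n M) : Prop :=
  ∀ ξ η : (∀ x : M, TangentSpace (𝓡 n) x), SmoothVecOn U ξ → SmoothVecOn U η →
    ∀ x ∈ U, opBracket L N ξ η x = 0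

/-- `L` and `N` commute and are strong symmetries of each other on `U`. -/
def StrongSymmetryOn (U : Set M) (L N : OpField n M) : Prop :=
  (∀ x ∈ U, L x * N x = N x * L x) ∧ BracketVanishesOn U L N

/-- `L` is a Nijenhuis operator on `U`: its Nijenhuis torsion `⟨L, L⟩` vanishes. -/
def NijenhuisOn (U : Set M) (L : OpField n M) : Prop := BracketVanishesOn U L L

/-- The symmetry algebra `Sym(B^1, …, B^n)` on `U`: the smooth common strong symmetries of the
`B^i`.  (Values of operator fields outside `U` are irrelevant and left free.) -/
def Sym (U : Set M) (B : Fin n → OpField n M) : Set (OpField n M) :=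
  {N | SmoothOpOn U N ∧ ∀ i, StrongSymmetryOn U N (B i)}

/-- The setup in which symmetry algebras are considered: smooth commuting operator fields
`B^1, …, B^n` on `U` that are strong symmetries of each other and such that at each point
`B^1 ξ, …, B^n ξ` are linearly independent for some vector `ξ`, and
`(B^1)^* a, …, (B^n)^* a` are linearly independent for some covector `a`. -/
structure GeneratesSym (U : Set M) (B : Fin n → OpField n M) : Prop where
  smooth : ∀ i, SmoothOpOn U (B i)
  strong : ∀ i j, StrongSymmetryOn U (B i) (B j)
  cyclic : ∀ x ∈ U, ∃ ξ : TangentSpace (𝓡 n) x, LinearIndependent ℝ fun i => B i x ξ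
  cocyclic : ∀ x ∈ U, ∃ a : Cotangent n x, LinearIndependent ℝ fun i => a ∘ₗ B i x

/-- `B^1, …, B^n` is a basis of the symmetry algebra `S` on `U`: the `B^i` belong to `S`, and each
element of `S` is a linear combination of them, unique at each point, whose coefficients are smooth
functions. -/
structure IsBasisOfSym (U : Set M) (S : Set (OpField n M)) (B : Fin n → OpField n M) : Prop where
  mem : ∀ i, B i ∈ S
  indep : ∀ x ∈ U, LinearIndependent ℝ fun i => B i x
  span : ∀ N ∈ S, ∃ g : Fin n → M → ℝ,
    (∀ i, ContMDiffOn (𝓡 n) 𝓘(ℝ, ℝ) ∞ (g i) U) ∧ ∀ x ∈ U, N x = ∑ i, g i x • B i x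

end Symmetries

section Killing

variable {n : ℕ} [NeZero n] {M : Type*} [TopologicalSpace M]
  [ChartedSpace (EuclideanSpace ℝ (Fin n)) M]

/-- The first tensor `h_1` of the collection (index `0` in Lean) is nondegenerate. -/
def FirstNondegenerate (h : Fin n → CoTensor n M) : Prop :=
  ∀ x : M, Function.Bijective (h 0 x)

/-- `h_1⁻¹`, as a map from vectors to covectors. -/
def lower (h : Fin n → CoTensor n M) (hnd : FirstNondegenerate h) (x : M) :
    TangentSpace (𝓡 n) x →ₗ[ℝ] Cotangent n x :=
  (LinearEquiv.ofBijective (h 0 x) (hnd x)).symm.toLinearMap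

/-- The Killing tensors `K_s = h_s h_1⁻¹`. -/
def killing (h : Fin n → CoTensor n M) (hnd : FirstNondegenerate h) (s : Fin n) : OpField n M :=
  fun x => h s x ∘ₗ lower h hnd x

/-- The operators `∑_s b^{is} K_s`, with `(b^{is})` the inverse of the matrix `(b_{is})`: the dual
operators of `K_1, …, K_n` with respect to the bilinear form with `b(K_i, K_s) = b_{is}`. -/
def dualOps (K : Fin n → OpField n M) (b : M → Matrix (Fin n) (Fin n) ℝ) (i : Fin n) :
    OpField n M :=
  fun x => ∑ s, (b x)⁻¹ i s • K s x

/-- The matrix `∑_s a_{ij}^s c_s`, for structure functions `a i j s = a_{ij}^s` and constants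
`c_s`. -/
def frobeniusMatrix (a : Fin n → Fin n → Fin n → M → ℝ) (c : Fin n → ℝ) (x : M) :
    Matrix (Fin n) (Fin n) ℝ :=
  Matrix.of fun i j => ∑ s, a i j s x * c s

/-- The vector `∂F_s/∂p = 2 h_s^{ij} α_j`: the projection to the base of the Hamiltonian vector
field of `F_s` at the points of the graph of `α`. -/
def velocity (h : Fin n → CoTensor n M) (α : OneForm n M) (s : Fin n) (x : M) :
    TangentSpace (𝓡 n) x :=
  (2 : ℝ) • h s x (α x)

/-- The graph of the 1-form `α` over `U` is a common level surface `F_1 = c_1, …, F_n = c_n` at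
whose points `det (∂F/∂p) ≠ 0`. -/
structure IsRegularLevel (h : Fin n → CoTensor n M) (U : Set M) (α : OneForm n M) : Prop where
  smooth : SmoothFormOn U α
  level : ∀ s, ∃ c : ℝ, ∀ x ∈ U, quadFun (h s) x (α x) = c
  regular : ∀ x ∈ U, LinearIndependent ℝ fun s => velocity h α s x

/-- The matrix `b_{ij} = g(ξ_i, ξ_j)` of the metric `g = h_1⁻¹` in the frame
`ξ_s = ∂F_s/∂p` along the level surface that is the graph of `α`. -/
def levelMatrix (h : Fin n → CoTensor n M) (hnd : FirstNondegenerate h) (α : OneForm n M) (x : M) :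
    Matrix (Fin n) (Fin n) ℝ :=
  Matrix.of fun i j => lower h hnd x (velocity h α i x) (velocity h α j x)

/-- The operator fields `M^1, …, M^n` attached to the Poisson commuting functions `F_1, …, F_n` and
to a common level surface (the graph of `α`): they are dual to the Killing tensors `K_1, …, K_n`
with respect to the form `b(K_i, K_j) = g(ξ_i, ξ_j)`. -/
def levelOps (h : Fin n → CoTensor n M) (hnd : FirstNondegenerate h) (α : OneForm n M) :
    Fin n → OpField n M :=
  dualOps (killing h hnd) (levelMatrix h hnd α)

end Killing

end OperatorFrobenius

end

/-! The engine is a Liouville-type fact: a 1-form whose graph lies in a common level of Poisson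
commuting functions with independent fibre derivatives is closed. Let `α` be a regular level. The
operators `M^i` are self-adjoint for every `h_s`, and duality gives `α(M^i h_s α) = δ_is / 4`. Hence
for every sum `N` of them, `F_s(α ∘ √(1 + τN)) = α((1 + τN) h_s α)` is independent of the point at
each order in `τ`. The Liouville fact for formal series (`closed_of_formal_level`) makes every `α ∘
N^m` with `m ≤ 3` closed, and polarization gives closedness of `α ∘ M^k`, `α ∘ M^k M^i` and `α ∘ M^k
M^i M^j`. For `γ = α ∘ M^k`, closedness of `γ`, `γ ∘ M^i`, `γ ∘ M^j` and `γ ∘ M^i M^j` yields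
`γ(⟨M^i, M^j⟩) = 0` by Cartan's formula. These `γ` form a coframe, so all the brackets vanish
(`IsRegularLevel.bracketVanishesOn`).

The rest is algebra. Since `K_i K_j = ∑ a_ij^s K_s`, the matrix `g(ξ_i, ξ_j)` equals `∑ a_ij^s d_s`
with `d_s = 4 F_s(α)`, which are constants. So the `M^i` and the operators built from prescribed
constants `c` are dual bases of one commutative algebra, for the functionals `K_s ↦ d_s` and `K_s ↦
c_s`. The factor `P = ∑ c_j M^j` converts one functional into the other: `P M̄^i = M^i` and `P⁻¹ = ∑
d_j M̄^j` (`sum_smul_dualFamily_mul`, `sum_smul_dualFamily_mul_sum`). The commuting operators with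
vanishing bracket against a fixed operator are stable under constant combinations, products and
inverses, so strong symmetries pass from one dual family to the other
(`KillingSystem.strongSymmetryOn_of`).

The vanishing of brackets is local, and regular levels exist locally by the inverse function theorem
(`exists_isRegularLevel`), so the claims about `M̄^i` need no global level. Finally, an operator
commuting with all `K_s` is determined by its value on a cyclic vector, hence lies in their span.
This yields the structure functions and the basis property. -/

noncomputable section

namespace OperatorFrobenius

/-! ### Coefficients of products of three power series -/

section TripleSums

open Finset

/-- The sum of `f j k l` over all `j + k + l = m`. -/
def tripleSum (m : ℕ) (f : ℕ → ℕ → ℕ → ℝ) : ℝ :=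
  ∑ j ∈ range (m + 1), ∑ k ∈ range (m + 1), ∑ l ∈ range (m + 1),
    if j + k + l = m then f j k l else 0

theorem tripleSum_rotate (m : ℕ) (f : ℕ → ℕ → ℕ → ℝ) :
    tripleSum m (fun j k l => f k l j) = tripleSum m f := by
  unfold tripleSum
  rw [sum_comm]
  refine sum_congr rfl fun k _ => ?_
  rw [sum_comm]
  refine sum_congr rfl fun l _ => sum_congr rfl fun j _ => ?_
  congr 1
  exact propext ⟨fun h => by omega, fun h => by omega⟩

theorem tripleSum_swap_last (m : ℕ) (f : ℕ → ℕ → ℕ → ℝ) :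
    tripleSum m (fun j k l => f j l k) = tripleSum m f := by
  unfold tripleSum
  refine sum_congr rfl fun j _ => ?_
  rw [sum_comm]
  refine sum_congr rfl fun l _ => sum_congr rfl fun k _ => ?_
  congr 1
  exact propext ⟨fun h => by omega, fun h => by omega⟩

theorem tripleSum_swap_first (m : ℕ) (f : ℕ → ℕ → ℕ → ℝ) :
    tripleSum m (fun j k l => f k j l) = tripleSum m f := by
  rw [← tripleSum_swap_last m f, ← tripleSum_rotate m (fun j k l => f j l k)]

theorem tripleSum_add (m : ℕ) (f g : ℕ → ℕ → ℕ → ℝ) :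
    tripleSum m (fun j k l => f j k l + g j k l) = tripleSum m f + tripleSum m g := by
  unfold tripleSum
  simp only [← sum_add_distrib]
  refine sum_congr rfl fun j _ => sum_congr rfl fun k _ => sum_congr rfl fun l _ => ?_
  split_ifs <;> simp

theorem tripleSum_smul (m : ℕ) (c : ℝ) (f : ℕ → ℕ → ℕ → ℝ) :
    tripleSum m (fun j k l => c * f j k l) = c * tripleSum m f := by
  unfold tripleSum
  simp only [mul_sum]
  refine sum_congr rfl fun j _ => sum_congr rfl fun k _ => sum_congr rfl fun l _ => ?_
  split_ifs <;> simp

theorem tripleSum_sub (m : ℕ) (f g : ℕ → ℕ → ℕ → ℝ) :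
    tripleSum m (fun j k l => f j k l - g j k l) = tripleSum m f - tripleSum m g := by
  have h := tripleSum_add m (fun j k l => f j k l - g j k l) g
  simp only [sub_add_cancel] at h
  exact eq_sub_of_add_eq h.symm

theorem tripleSum_eq_zero_of_cyclic (m : ℕ) (f : ℕ → ℕ → ℕ → ℝ)
    (h : ∀ j k l, f j k l + f k l j + f l j k = 0) : tripleSum m f = 0 := by
  have h1 := tripleSum_rotate m f
  have h2 := tripleSum_rotate m (fun j k l => f k l j)
  have h3 : tripleSum m (fun j k l => f j k l + f k l j + f l j k) = 0 := by
    simp only [h]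
    simp [tripleSum]
  rw [tripleSum_add, tripleSum_add] at h3
  linarith

theorem tripleSum_eq_sum_antidiagonal (m : ℕ) (f : ℕ → ℕ → ℕ → ℝ) :
    tripleSum m f = ∑ j ∈ range (m + 1), ∑ x ∈ HasAntidiagonal.antidiagonal (m - j), f j x.1 x.2 := by
  unfold tripleSum
  refine sum_congr rfl fun j hj => ?_
  rw [← sum_product', ← sum_filter]
  refine sum_congr ?_ fun _ _ => rfl
  ext ⟨k, l⟩
  simp only [mem_range, mem_filter, mem_product,
    HasAntidiagonal.mem_antidiagonal] at hj ⊢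
  omega

theorem tripleSum_eq_single (m : ℕ) (f : ℕ → ℕ → ℕ → ℝ) (h : ∀ j < m, ∀ k l, f j k l = 0) :
    tripleSum m f = f m 0 0 := by
  rw [tripleSum_eq_sum_antidiagonal, sum_range_succ, sum_eq_zero]
  · simp
  · intro j hj
    exact sum_eq_zero fun x _ => h j (mem_range.1 hj) _ _

end TripleSums

/-! ### Closedness of forms in common levels, order by order -/

section ClosedForms

variable {V : Type*} [NormedAddCommGroup V] [NormedSpace ℝ V]

/-- The polarization of a cubic identity. -/
theorem cyclic_eq_zero_of_cubic {E : Type*} [AddCommGroup E] [Module ℝ E]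
    (T : E →ₗ[ℝ] E →ₗ[ℝ] E →ₗ[ℝ] ℝ) (hsymm : ∀ p q r, T p q r = T r q p)
    (h : ∀ p, T p p p = 0) (p q r : E) : T p q r + T q r p + T r p q = 0 := by
  have h1 := h (p + q + r)
  have h2 := h (p + q)
  have h3 := h (q + r)
  have h4 := h (p + r)
  simp only [map_add, LinearMap.add_apply, h] at h1 h2 h3 h4
  linarith [hsymm p q r, hsymm q r p, hsymm r p q]

/-- A form with values `B j` and first derivatives `D j` has derivatives that satisfy the
triple-sum form of closedness on the vectors `Hs (B k)`, `Ht (B l)`. -/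
theorem tripleSum_exterior_eq_zero (B : ℕ → V →L[ℝ] ℝ) (D : ℕ → V →L[ℝ] V →L[ℝ] ℝ)
    (Hs Ht : (V →L[ℝ] ℝ) →L[ℝ] V) (Hs' Ht' : V →L[ℝ] (V →L[ℝ] ℝ) →L[ℝ] V)
    (hs' : ∀ u (p q : V →L[ℝ] ℝ), p (Hs' u q) = q (Hs' u p)) (ht' : ∀ u (p q : V →L[ℝ] ℝ), p (Ht' u q) = q (Ht' u p))
    (hpois : ∀ p : V →L[ℝ] ℝ, p (Ht' (Hs p) p) = p (Hs' (Ht p) p)) (m : ℕ)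
    (hds : ∀ k ≤ m, ∀ u, ∑ x ∈ Finset.HasAntidiagonal.antidiagonal k,
      (B x.1 (Hs' u (B x.2)) + 2 * D x.1 u (Hs (B x.2))) = 0)
    (hdt : ∀ k ≤ m, ∀ u, ∑ x ∈ Finset.HasAntidiagonal.antidiagonal k,
      (B x.1 (Ht' u (B x.2)) + 2 * D x.1 u (Ht (B x.2))) = 0) :
    tripleSum m (fun j k l => D j (Hs (B k)) (Ht (B l)) - D j (Ht (B l)) (Hs (B k))) = 0 := by
  -- `T p p p` is, up to a constant factor, the Poisson bracket at `p`. As `T` is symmetric in its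
  -- outer arguments, polarization kills its cyclic sums.
  let T : (V →L[ℝ] ℝ) →ₗ[ℝ] (V →L[ℝ] ℝ) →ₗ[ℝ] (V →L[ℝ] ℝ) →ₗ[ℝ] ℝ :=
    LinearMap.mk₂ ℝ (fun p q => (p.toLinearMap ∘ₗ (Ht' (Hs q)).toLinearMap) -
        p.toLinearMap ∘ₗ (Hs' (Ht q)).toLinearMap)
      (fun p p' q => by ext; simp; ring) (fun c p q => by ext; simp; ring)
      (fun p q q' => by ext; simp; ring) (fun c p q => by ext; simp; ring)
  have hT : ∀ p q r, T p q r = p (Ht' (Hs q) r) - p (Hs' (Ht q) r) := fun p q r => rfl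
  have hcyc := cyclic_eq_zero_of_cubic T (fun p q r => by rw [hT, hT, hs', ht'])
    (fun p => by rw [hT, hpois, sub_self])
  have h0 := tripleSum_eq_zero_of_cyclic m (fun j k l => T (B j) (B k) (B l))
    fun j k l => hcyc _ _ _
  -- The level equation, differentiated in the direction `u k` at order `m - k`, is summed over `k`.
  -- Below, `u k` is the other Hamiltonian velocity.
  have key : ∀ (H : (V →L[ℝ] ℝ) →L[ℝ] V) (H' : V →L[ℝ] (V →L[ℝ] ℝ) →L[ℝ] V) (u : ℕ → V),
      (∀ k ≤ m, ∀ u, ∑ x ∈ Finset.HasAntidiagonal.antidiagonal k,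
        (B x.1 (H' u (B x.2)) + 2 * D x.1 u (H (B x.2))) = 0) →
      tripleSum m (fun j k l => B j (H' (u k) (B l)) + 2 * D j (u k) (H (B l))) = 0 := by
    intro H H' u hd
    rw [← tripleSum_swap_first, tripleSum_eq_sum_antidiagonal]
    exact Finset.sum_eq_zero fun k _ => hd _ (Nat.sub_le _ _) _
  have h1 := key Ht Ht' (fun k => Hs (B k)) hdt
  have h2 := key Hs Hs' (fun k => Ht (B k)) hds
  simp only [hT] at h0
  rw [tripleSum_sub] at h0 ⊢
  rw [tripleSum_add, tripleSum_smul] at h1 h2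
  rw [← tripleSum_swap_last m (fun j k l => D j (Ht (B l)) (Hs (B k)))]
  linarith

/-- A differential 1-form on a subset of a vector space is closed there. -/
def FormClosedAt (γ : V → V →L[ℝ] ℝ) (y : V) : Prop :=
  DifferentiableAt ℝ γ y ∧ ∀ u w, fderiv ℝ γ y u w = fderiv ℝ γ y w u

/-- The Poisson commutation of the quadratic functions of `hs` and `ht` at the point `y`. -/
def PoissonAt (hs ht : V → (V →L[ℝ] ℝ) →L[ℝ] V) (y : V) : Prop :=
  ∀ p : V →L[ℝ] ℝ, p (fderiv ℝ ht y (hs y p) p) = p (fderiv ℝ hs y (ht y p) p)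

theorem fderiv_symm_of_symm {h : V → (V →L[ℝ] ℝ) →L[ℝ] V} {W : Set V} (hW : IsOpen W)
    (hd : DifferentiableOn ℝ h W) (hsymm : ∀ y ∈ W, ∀ p q : V →L[ℝ] ℝ, p (h y q) = q (h y p)) {y : V}
    (hy : y ∈ W) (u : V) (p q : V →L[ℝ] ℝ) :
    p (fderiv ℝ h y u q) = q (fderiv ℝ h y u p) := by
  have hy' := hW.mem_nhds hy
  have hdy := (hd.differentiableAt hy').hasFDerivAt
  have h1 : ∀ p q : V →L[ℝ] ℝ,
      HasFDerivAt (fun z => p (h z q)) (p ∘L ((fderiv ℝ h y).flip q)) y := by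
    intro p q
    have := p.hasFDerivAt.comp y (hdy.clm_apply (hasFDerivAt_const q y))
    rw [ContinuousLinearMap.comp_zero, zero_add] at this
    exact this
  have h2 : (fun z => p (h z q)) =ᶠ[nhds y] fun z => q (h z p) := by
    filter_upwards [hy'] with z hz using hsymm z hz p q
  have h3 := ((h1 p q).unique ((h1 q p).congr_of_eventuallyEq h2))
  simpa using congrArg (fun A => A u) h3

/-- If the forms `β 0, β 1, …` satisfy formally `F_s (∑ τ^m β_m) = const` up to order `N`, where the
quadratic functions `F_s` Poisson commute and are independent along `β 0`, then they are closed. -/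
theorem closed_of_formal_level {ι : Type*} {h : ι → V → (V →L[ℝ] ℝ) →L[ℝ] V} {W : Set V}
    (hW : IsOpen W) (hd : ∀ s, DifferentiableOn ℝ (h s) W)
    (hsymm : ∀ s, ∀ y ∈ W, ∀ p q : V →L[ℝ] ℝ, p (h s y q) = q (h s y p))
    (hpois : ∀ s t, ∀ y ∈ W, PoissonAt (h s) (h t) y) (β : ℕ → V → V →L[ℝ] ℝ)
    (hβ : ∀ m, DifferentiableOn ℝ (β m) W) (N : ℕ)
    (hlevel : ∀ m ≤ N, ∀ s, ∃ c : ℝ, ∀ y ∈ W,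
      ∑ x ∈ Finset.HasAntidiagonal.antidiagonal m, β x.1 y (h s y (β x.2 y)) = c)
    (hspan : ∀ y ∈ W, Submodule.span ℝ (Set.range fun s => h s y (β 0 y)) = ⊤) :
    ∀ m ≤ N, ∀ y ∈ W, FormClosedAt (β m) y := by
  intro m
  induction m using Nat.strong_induction_on with
  | _ m ih =>
  intro hm y hy
  have hy' := hW.mem_nhds hy
  refine ⟨(hβ m).differentiableAt hy', ?_⟩
  -- Derivative of the order-`k` level equation. Symmetry of `h s` merges the contributions of the
  -- two factors `β`, whence the 2.
  have hderiv : ∀ s, ∀ k ≤ m, ∀ u, ∑ x ∈ Finset.HasAntidiagonal.antidiagonal k,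
      (β x.1 y (fderiv ℝ (h s) y u (β x.2 y)) +
        2 * fderiv ℝ (β x.1) y u (h s y (β x.2 y))) = 0 := by
    intro s k hk u
    obtain ⟨c, hc⟩ := hlevel k (hk.trans hm) s
    have hβd : ∀ i, HasFDerivAt (β i) (fderiv ℝ (β i) y) y :=
      fun i => ((hβ i).differentiableAt hy').hasFDerivAt
    have h1 := HasFDerivAt.fun_sum (u := Finset.HasAntidiagonal.antidiagonal k) fun x _ =>
      (hβd x.1).clm_apply ((((hd s).differentiableAt hy').hasFDerivAt).clm_apply (hβd x.2))
    have h2 : (fun z => ∑ x ∈ Finset.HasAntidiagonal.antidiagonal k, β x.1 z (h s z (β x.2 z))) =ᶠ[nhds y]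
        fun _ => c := by
      filter_upwards [hy'] with z hz using hc z hz
    have h3 := h1.unique ((hasFDerivAt_const c y).congr_of_eventuallyEq h2)
    have h4 := congrArg (fun A => A u) h3
    simp only [sum_apply, add_apply,
      ContinuousLinearMap.comp_apply, ContinuousLinearMap.flip_apply,
      zero_apply, map_add] at h4
    have h5 : ∑ x ∈ Finset.HasAntidiagonal.antidiagonal k, β x.1 y (h s y (fderiv ℝ (β x.2) y u)) =
        ∑ x ∈ Finset.HasAntidiagonal.antidiagonal k, fderiv ℝ (β x.1) y u (h s y (β x.2 y)) := by
      rw [← Finset.Nat.sum_antidiagonal_swap]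
      exact Finset.sum_congr rfl fun x _ => hsymm s y hy _ _
    rw [Finset.sum_add_distrib, Finset.sum_add_distrib, h5] at h4
    rw [Finset.sum_add_distrib, ← Finset.mul_sum]
    linarith
  have hzero : ∀ s t, fderiv ℝ (β m) y (h s y (β 0 y)) (h t y (β 0 y)) =
      fderiv ℝ (β m) y (h t y (β 0 y)) (h s y (β 0 y)) := by
    intro s t
    have h1 := tripleSum_exterior_eq_zero (fun i => β i y) (fun i => fderiv ℝ (β i) y)
      (h s y) (h t y) (fderiv ℝ (h s) y) (fderiv ℝ (h t) y)
      (fun u p q => fderiv_symm_of_symm hW (hd s) (hsymm s) hy u p q)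
      (fun u p q => fderiv_symm_of_symm hW (hd t) (hsymm t) hy u p q)
      (hpois s t y hy) m (hderiv s) (hderiv t)
    -- The lower-order forms are closed by induction, so only the term `j = m`, `k = l = 0` is left.
    rw [tripleSum_eq_single] at h1
    · exact sub_eq_zero.1 h1
    · intro j hj k l
      rw [(ih j hj (hj.le.trans hm) y hy).2, sub_self]
  intro u w
  have hu : u ∈ Submodule.span ℝ (Set.range fun s => h s y (β 0 y)) := by rw [hspan y hy]; trivial
  have hw : w ∈ Submodule.span ℝ (Set.range fun s => h s y (β 0 y)) := by rw [hspan y hy]; trivial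
  induction hu, hw using Submodule.span_induction₂ with
  | mem_mem u w hu hw =>
    obtain ⟨s, rfl⟩ := hu
    obtain ⟨t, rfl⟩ := hw
    exact hzero s t
  | zero_left w _ => simp
  | zero_right u _ => simp
  | add_left u u' w _ _ _ h1 h2 => simp [h1, h2]
  | add_right u w w' _ _ _ h1 h2 => simp [h1, h2]
  | smul_left c u w _ _ h1 => simp [h1]
  | smul_right c u w _ _ h1 => simp [h1]

end ClosedForms

/-! ### Closed forms `α ∘ N^m` from the square root series -/

section FormalPowers

variable {V : Type*} [NormedAddCommGroup V] [NormedSpace ℝ V]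

theorem FormClosedAt.congr {γ δ : V → V →L[ℝ] ℝ} {y : V} (h : FormClosedAt γ y)
    (hδ : δ =ᶠ[nhds y] γ) : FormClosedAt δ y := by
  refine ⟨h.1.congr_of_eventuallyEq hδ, fun u w => ?_⟩
  rw [hδ.fderiv_eq]
  exact h.2 u w

theorem FormClosedAt.add {γ δ : V → V →L[ℝ] ℝ} {y : V} (hγ : FormClosedAt γ y)
    (hδ : FormClosedAt δ y) : FormClosedAt (fun z => γ z + δ z) y := by
  refine ⟨hγ.1.add hδ.1, fun u w => ?_⟩
  rw [fderiv_fun_add hγ.1 hδ.1]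
  simp [hγ.2 u w, hδ.2 u w]

theorem FormClosedAt.smul {γ : V → V →L[ℝ] ℝ} {y : V} (c : ℝ) (hγ : FormClosedAt γ y) :
    FormClosedAt (fun z => c • γ z) y := by
  refine ⟨hγ.1.const_smul c, fun u w => ?_⟩
  rw [fderiv_fun_const_smul hγ.1]
  simp [hγ.2 u w]

/-- The first coefficients of the power series of `√(1 + τ)`. -/
def sqrtCoeff : ℕ → ℝ
  | 0 => 1
  | 1 => 1 / 2
  | 2 => -1 / 8
  | 3 => 1 / 16
  | _ => 0

theorem sum_sqrtCoeff_eq_zero {m : ℕ} (hm : m ≤ 3) (hm' : 2 ≤ m) :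
    ∑ x ∈ Finset.HasAntidiagonal.antidiagonal m, sqrtCoeff x.1 * sqrtCoeff x.2 = 0 := by
  interval_cases m <;> simp [Finset.Nat.antidiagonal_succ, sqrtCoeff] <;> norm_num

theorem sqrtCoeff_ne_zero {m : ℕ} (hm : m ≤ 3) : sqrtCoeff m ≠ 0 := by
  interval_cases m <;> norm_num [sqrtCoeff]

/-- Along the form `α`, the operator field `N` is a differentiable infinitesimal deformation of the
levels of the quadratic functions of the tensors `h s`. -/
structure LevelDeformation {ι : Type*} (h : ι → V → (V →L[ℝ] ℝ) →L[ℝ] V) (α : V → V →L[ℝ] ℝ)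
    (W : Set V) (N : V → V →L[ℝ] V) : Prop where
  diff : DifferentiableOn ℝ N W
  adjoint : ∀ s, ∀ y ∈ W, ∀ p : V →L[ℝ] ℝ, N y (h s y p) = h s y (p ∘L N y)
  const : ∀ s, ∃ c : ℝ, ∀ y ∈ W, α y (N y (h s y (α y))) = c

theorem LevelDeformation.add {ι : Type*} {h : ι → V → (V →L[ℝ] ℝ) →L[ℝ] V} {α : V → V →L[ℝ] ℝ}
    {W : Set V} {A B : V → V →L[ℝ] V} (hA : LevelDeformation h α W A)
    (hB : LevelDeformation h α W B) : LevelDeformation h α W (fun y => A y + B y) := by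
  refine ⟨hA.diff.add hB.diff, fun s y hy p => ?_, fun s => ?_⟩
  · simp [hA.adjoint s y hy p, hB.adjoint s y hy p]
  · obtain ⟨a, ha⟩ := hA.const s
    obtain ⟨b, hb⟩ := hB.const s
    exact ⟨a + b, fun y hy => by simp [ha y hy, hb y hy]⟩

/-- The local data of a regular common level `α` of Poisson commuting quadratic functions. -/
structure LocalLevel {ι : Type*} (h : ι → V → (V →L[ℝ] ℝ) →L[ℝ] V) (α : V → V →L[ℝ] ℝ)
    (W : Set V) : Prop where
  isOpen : IsOpen W
  diff : ∀ s, DifferentiableOn ℝ (h s) W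
  symm : ∀ s, ∀ y ∈ W, ∀ p q : V →L[ℝ] ℝ, p (h s y q) = q (h s y p)
  poisson : ∀ s t, ∀ y ∈ W, PoissonAt (h s) (h t) y
  diff_form : DifferentiableOn ℝ α W
  level : ∀ s, ∃ c : ℝ, ∀ y ∈ W, α y (h s y (α y)) = c
  span : ∀ y ∈ W, Submodule.span ℝ (Set.range fun s => h s y (α y)) = ⊤

variable {ι : Type*} {h : ι → V → (V →L[ℝ] ℝ) →L[ℝ] V} {α : V → V →L[ℝ] ℝ} {W : Set V}

theorem LevelDeformation.adjoint_pow {N : V → V →L[ℝ] V} (hN : LevelDeformation h α W N) (s : ι)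
    {y : V} (hy : y ∈ W) (p : V →L[ℝ] ℝ) (l : ℕ) :
    h s y (p ∘L N y ^ l) = (N y ^ l) (h s y p) := by
  induction l generalizing p with
  | zero => simp [ContinuousLinearMap.one_def]
  | succ l ih =>
    have : p ∘L N y ^ (l + 1) = (p ∘L N y) ∘L N y ^ l := by
      rw [pow_succ']; rfl
    rw [this, ih, ← hN.adjoint s y hy, pow_succ]
    rfl

theorem differentiableOn_comp_pow (hα : DifferentiableOn ℝ α W) {N : V → V →L[ℝ] V}
    (hN : DifferentiableOn ℝ N W) (m : ℕ) :
    DifferentiableOn ℝ (fun y => α y ∘L N y ^ m) W :=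
  hα.clm_comp (hN.fun_pow m)

/-- The forms `sqrtCoeff k • α ∘ N^k` are the coefficients of `α ∘ √(1 + τN)`. Self-adjointness of
`N` turns the value of a quadratic function on this series into `α((1 + τN) h_s α)`. Order 3
suffices because at most triple products of operators are needed later. -/
theorem LocalLevel.closed_comp_pow (H : LocalLevel h α W) {N : V → V →L[ℝ] V}
    (hN : LevelDeformation h α W N) {m : ℕ} (hm : m ≤ 3) {y : V} (hy : y ∈ W) :
    FormClosedAt (fun z => α z ∘L N z ^ m) y := by
  have hone : ∀ z, α z ∘L N z ^ 0 = α z := fun z => by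
    rw [pow_zero]; rfl
  have hclosed := closed_of_formal_level H.isOpen H.diff H.symm H.poisson
    (fun k z => sqrtCoeff k • (α z ∘L N z ^ k))
    (fun k => (differentiableOn_comp_pow H.diff_form hN.diff k).fun_const_smul _) 3 ?_ ?_ m hm y hy
  · refine (hclosed.smul (sqrtCoeff m)⁻¹).congr (Filter.Eventually.of_forall fun z => ?_)
    simp only
    rw [smul_smul, inv_mul_cancel₀ (sqrtCoeff_ne_zero hm), one_smul]
  · intro k hk s
    have hsum : ∀ z ∈ W, ∑ x ∈ Finset.HasAntidiagonal.antidiagonal k,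
        (sqrtCoeff x.1 • (α z ∘L N z ^ x.1)) (h s z (sqrtCoeff x.2 • (α z ∘L N z ^ x.2))) =
        (∑ x ∈ Finset.HasAntidiagonal.antidiagonal k, sqrtCoeff x.1 * sqrtCoeff x.2) *
          α z ((N z ^ k) (h s z (α z))) := by
      intro z hz
      rw [Finset.sum_mul]
      refine Finset.sum_congr rfl fun x hx => ?_
      rw [Finset.HasAntidiagonal.mem_antidiagonal] at hx
      rw [map_smul, hN.adjoint_pow s hz, ← hx, pow_add]
      simp
      ring
    -- Order 0 is the level condition on `α`, order 1 the deformation condition on `N`. Orders 2 and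
    -- 3 vanish because the series squares to `1 + τ`.
    rcases Nat.lt_or_ge k 2 with hk2 | hk2
    · interval_cases k
      · obtain ⟨c, hc⟩ := H.level s
        exact ⟨c, fun z hz => by rw [hsum z hz]; simp [sqrtCoeff, hc z hz]⟩
      · obtain ⟨c, hc⟩ := hN.const s
        refine ⟨c, fun z hz => ?_⟩
        rw [hsum z hz]
        simp [sqrtCoeff, Finset.Nat.antidiagonal_succ, hc z hz]
        ring
    · exact ⟨0, fun z hz => by rw [hsum z hz, sum_sqrtCoeff_eq_zero hk hk2, zero_mul]⟩
  · intro z hz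
    simp only [hone, sqrtCoeff, one_smul]
    exact H.span z hz

theorem LocalLevel.closed_comp (H : LocalLevel h α W) {A : V → V →L[ℝ] V}
    (hA : LevelDeformation h α W A) {y : V} (hy : y ∈ W) :
    FormClosedAt (fun z => α z ∘L A z) y := by
  simpa using H.closed_comp_pow hA (m := 1) (by norm_num) hy

/-- Deformations are closed under addition, so `2AB = (A + B)² - A² - B²` reduces the product to
squares. -/
theorem LocalLevel.closed_comp_mul (H : LocalLevel h α W) {A B : V → V →L[ℝ] V}
    (hA : LevelDeformation h α W A) (hB : LevelDeformation h α W B)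
    (hAB : ∀ y ∈ W, A y * B y = B y * A y) {y : V} (hy : y ∈ W) :
    FormClosedAt (fun z => α z ∘L (A z * B z)) y := by
  have h2 : (2 : ℕ) ≤ 3 := by norm_num
  refine ((((H.closed_comp_pow (hA.add hB) h2 hy).add
    ((H.closed_comp_pow hA h2 hy).smul (-1))).add
    ((H.closed_comp_pow hB h2 hy).smul (-1))).smul (1 / 2)).congr ?_
  filter_upwards [H.isOpen.mem_nhds hy] with z hz
  have hz := hAB z hz
  simp only [← ContinuousLinearMap.comp_smul, ← ContinuousLinearMap.comp_add]
  congr 1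
  simp only [pow_two, mul_add, add_mul, ← hz]
  module

/-- Polarization of the cube: it reduces triple products of commuting deformations to cubes of sums.
-/
theorem six_smul_mul_mul {R : Type*} [Ring R] {a b c : R} (hab : a * b = b * a)
    (hac : a * c = c * a) (hbc : b * c = c * b) :
    (6 : ℤ) • (a * b * c) = (a + b + c) ^ 3 - (a + b) ^ 3 - (b + c) ^ 3 - (a + c) ^ 3 +
      a ^ 3 + b ^ 3 + c ^ 3 := by
  have hab' : ∀ x, b * (a * x) = a * (b * x) := fun x => by rw [← mul_assoc, ← hab, mul_assoc]
  have hac' : ∀ x, c * (a * x) = a * (c * x) := fun x => by rw [← mul_assoc, ← hac, mul_assoc]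
  have hbc' : ∀ x, c * (b * x) = b * (c * x) := fun x => by rw [← mul_assoc, ← hbc, mul_assoc]
  simp only [pow_succ, pow_zero, one_mul, mul_add, add_mul, mul_assoc, ← hab, ← hac, ← hbc,
    hab', hac', hbc']
  abel

theorem LocalLevel.closed_comp_mul_mul (H : LocalLevel h α W) {A B C : V → V →L[ℝ] V}
    (hA : LevelDeformation h α W A) (hB : LevelDeformation h α W B)
    (hC : LevelDeformation h α W C) (hAB : ∀ y ∈ W, A y * B y = B y * A y)
    (hAC : ∀ y ∈ W, A y * C y = C y * A y) (hBC : ∀ y ∈ W, B y * C y = C y * B y)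
    {y : V} (hy : y ∈ W) : FormClosedAt (fun z => α z ∘L (A z * B z * C z)) y := by
  have h3 : (3 : ℕ) ≤ 3 := le_rfl
  refine (((((((H.closed_comp_pow ((hA.add hB).add hC) h3 hy).add
    ((H.closed_comp_pow (hA.add hB) h3 hy).smul (-1))).add
    ((H.closed_comp_pow (hB.add hC) h3 hy).smul (-1))).add
    ((H.closed_comp_pow (hA.add hC) h3 hy).smul (-1))).add
    (H.closed_comp_pow hA h3 hy)).add (H.closed_comp_pow hB h3 hy)).add
    (H.closed_comp_pow hC h3 hy) |>.smul (1 / 6)).congr ?_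
  filter_upwards [H.isOpen.mem_nhds hy] with z hz
  have h6 := six_smul_mul_mul (hAB z hz) (hAC z hz) (hBC z hz)
  have h6' : A z * B z * C z = (1 / 6 : ℝ) • ((6 : ℤ) • (A z * B z * C z)) := by
    module
  simp only [← ContinuousLinearMap.comp_smul, ← ContinuousLinearMap.comp_add]
  congr 1
  rw [h6', h6]
  module

end FormalPowers

/-! ### From closed forms to vanishing brackets -/

section LinearBracket

variable {V : Type*} [NormedAddCommGroup V] [NormedSpace ℝ V]

open VectorField

/-- `⟨L, N⟩(ξ, η)` on a vector space. -/
def flatBracket (L N : V → V →L[ℝ] V) (ξ η : V → V) (y : V) : V :=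
  L y (N y (lieBracket ℝ ξ η y)) + lieBracket ℝ (fun z => L z (ξ z)) (fun z => N z (η z)) y -
    L y (lieBracket ℝ ξ (fun z => N z (η z)) y) - N y (lieBracket ℝ (fun z => L z (ξ z)) η y)

theorem FormClosedAt.apply_lieBracket {γ : V → V →L[ℝ] ℝ} {y : V} (hγ : FormClosedAt γ y)
    {ξ η : V → V} (hξ : DifferentiableAt ℝ ξ y) (hη : DifferentiableAt ℝ η y) :
    γ y (lieBracket ℝ ξ η y) =
      fderiv ℝ (fun z => γ z (η z)) y (ξ y) - fderiv ℝ (fun z => γ z (ξ z)) y (η y) := by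
  rw [fderiv_clm_apply hγ.1 hη, fderiv_clm_apply hγ.1 hξ, lieBracket_eq]
  simp [hγ.2 (ξ y) (η y)]

/-- Cartan's formula rewrites the four brackets through derivatives of functions, using respectively
`γ ∘ LN`, `γ`, `γ ∘ L` and `γ ∘ N`. All terms cancel in pairs once `γ(NLξ)` is identified with
`γ(LNξ)` near the point. -/
theorem apply_flatBracket_eq_zero {γ : V → V →L[ℝ] ℝ} {L N : V → V →L[ℝ] V} {ξ η : V → V} {y : V}
    (hξ : DifferentiableAt ℝ ξ y) (hη : DifferentiableAt ℝ η y) (hL : DifferentiableAt ℝ L y)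
    (hN : DifferentiableAt ℝ N y) (hLN : ∀ᶠ z in nhds y, L z * N z = N z * L z)
    (h1 : FormClosedAt γ y) (h2 : FormClosedAt (fun z => γ z ∘L L z) y)
    (h3 : FormClosedAt (fun z => γ z ∘L N z) y)
    (h4 : FormClosedAt (fun z => γ z ∘L (L z * N z)) y) :
    γ y (flatBracket L N ξ η y) = 0 := by
  have hLξ : DifferentiableAt ℝ (fun z => L z (ξ z)) y := hL.clm_apply hξ
  have hNη : DifferentiableAt ℝ (fun z => N z (η z)) y := hN.clm_apply hη
  have e1 := h1.apply_lieBracket hLξ hNη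
  have e2 := h2.apply_lieBracket hξ hNη
  have e3 := h3.apply_lieBracket hLξ hη
  have e4 := h4.apply_lieBracket hξ hη
  have e5 : (fun z => γ z (N z (L z (ξ z)))) =ᶠ[nhds y] fun z => γ z (L z (N z (ξ z))) := by
    filter_upwards [hLN] with z hz
    exact congrArg (fun A : V →L[ℝ] V => γ z (A (ξ z))) hz.symm
  simp only [ContinuousLinearMap.comp_apply, mul_apply_eq_comp] at e1 e2 e3 e4
  rw [e5.fderiv_eq] at e3
  rw [flatBracket, map_sub, map_sub, map_add, e1, e2, e3, e4]
  ring

/-- The covectors `α ∘ B k` separate vectors, so it is enough to test the bracket on them. Testing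
`B i`, `B j` against `α ∘ B k` is what requires triple products. -/
theorem LocalLevel.flatBracket_eq_zero {ι : Type*} {h : ι → V → (V →L[ℝ] ℝ) →L[ℝ] V}
    {α : V → V →L[ℝ] ℝ} {W : Set V} (H : LocalLevel h α W) {κ : Type*} {B : κ → V → V →L[ℝ] V}
    (hB : ∀ i, LevelDeformation h α W (B i))
    (hcomm : ∀ i j, ∀ y ∈ W, B i y * B j y = B j y * B i y)
    {y : V} (hy : y ∈ W) (hco : ∀ v, (∀ k, α y (B k y v) = 0) → v = 0) {ξ η : V → V}
    (hξ : DifferentiableAt ℝ ξ y) (hη : DifferentiableAt ℝ η y) (i j : κ) :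
    flatBracket (B i) (B j) ξ η y = 0 := by
  have hd : ∀ i, DifferentiableAt ℝ (B i) y :=
    fun i => (hB i).diff.differentiableAt (H.isOpen.mem_nhds hy)
  refine hco _ fun k => ?_
  refine apply_flatBracket_eq_zero (γ := fun z => α z ∘L B k z) hξ hη (hd i) (hd j) ?_
    (H.closed_comp (hB k) hy) (H.closed_comp_mul (hB k) (hB i) (hcomm k i) hy)
    (H.closed_comp_mul (hB k) (hB j) (hcomm k j) hy)
    (H.closed_comp_mul_mul (hB k) (hB i) (hB j) (hcomm k i) (hcomm k j) (hcomm i j) hy)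
  filter_upwards [H.isOpen.mem_nhds hy] with z hz using hcomm i j z hz

end LinearBracket

/-! ### Dual bases in a commutative algebra for different functionals -/

section FrobeniusAlgebra

variable {ι : Type*} {A : Type*} [Ring A] [Algebra ℝ A] {K : ι → A} {a : ι → ι → ι → ℝ}

theorem exists_functional (hK : LinearIndependent ℝ K) (c : ι → ℝ) :
    ∃ ε : A →ₗ[ℝ] ℝ, ∀ s, ε (K s) = c s := by
  obtain ⟨ε, hε⟩ := LinearMap.exists_extend ((Module.Basis.span hK).constr ℝ c)
  refine ⟨ε, fun s => ?_⟩
  have h := congrArg (fun f => f (Module.Basis.span hK s)) hε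
  simpa [Module.Basis.span_apply hK s, -Module.Basis.constr_basis] using
    h.trans (Module.Basis.constr_basis _ _ _ _)

variable [Fintype ι]

/-- The matrix of the bilinear form that the functional `K s ↦ c s` defines in the algebra with
structure constants `a`. -/
def structureMatrix (a : ι → ι → ι → ℝ) (c : ι → ℝ) : Matrix ι ι ℝ :=
  Matrix.of fun i j => ∑ s, a i j s * c s

theorem mul_mem_span (ha : ∀ i j, K i * K j = ∑ s, a i j s • K s) {x y : A}
    (hx : x ∈ Submodule.span ℝ (Set.range K)) (hy : y ∈ Submodule.span ℝ (Set.range K)) :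
    x * y ∈ Submodule.span ℝ (Set.range K) := by
  induction hx, hy using Submodule.span_induction₂ with
  | mem_mem x y hx hy =>
    obtain ⟨i, rfl⟩ := hx
    obtain ⟨j, rfl⟩ := hy
    rw [ha]
    exact Submodule.sum_mem _ fun s _ => Submodule.smul_mem _ _ (Submodule.subset_span ⟨s, rfl⟩)
  | zero_left y _ => simp
  | zero_right x _ => simp
  | add_left x x' y _ _ _ h1 h2 => rw [add_mul]; exact Submodule.add_mem _ h1 h2
  | add_right x y y' _ _ _ h1 h2 => rw [mul_add]; exact Submodule.add_mem _ h1 h2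
  | smul_left c x y _ _ h1 => rw [smul_mul_assoc]; exact Submodule.smul_mem _ _ h1
  | smul_right c x y _ _ h1 => rw [mul_smul_comm]; exact Submodule.smul_mem _ _ h1

theorem functional_mul {c : ι → ℝ} (ha : ∀ i j, K i * K j = ∑ s, a i j s • K s) {ε : A →ₗ[ℝ] ℝ}
    (hε : ∀ s, ε (K s) = c s) (i j : ι) : ε (K i * K j) = structureMatrix a c i j := by
  simp [ha, hε, structureMatrix]

variable [DecidableEq ι]

/-- The combinations of the `K s` with coefficients in the rows of `b⁻¹`. -/
def dualFamily (K : ι → A) (b : Matrix ι ι ℝ) (i : ι) : A := ∑ s, b⁻¹ i s • K s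

theorem sum_smul_dualFamily (K : ι → A) {b : Matrix ι ι ℝ} (hb : b.det ≠ 0) (k : ι) :
    ∑ i, b k i • dualFamily K b i = K k := by
  simp only [dualFamily, Finset.smul_sum, smul_smul]
  rw [Finset.sum_comm]
  have h : ∀ s, ∑ i, (b k i * b⁻¹ i s) • K s = (1 : Matrix ι ι ℝ) k s • K s := by
    intro s
    rw [← Finset.sum_smul, ← Matrix.mul_apply, Matrix.mul_nonsing_inv _ hb.isUnit]
  simp only [h, Matrix.one_apply, ite_smul, one_smul, zero_smul]
  simp

theorem dualFamily_mem_span (K : ι → A) (b : Matrix ι ι ℝ) (i : ι) :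
    dualFamily K b i ∈ Submodule.span ℝ (Set.range K) :=
  Submodule.sum_mem _ fun s _ => Submodule.smul_mem _ _ (Submodule.subset_span ⟨s, rfl⟩)

theorem linearIndependent_dualFamily {E : Type*} [AddCommGroup E] [Module ℝ E] {k : ι → E}
    (hk : LinearIndependent ℝ k) {b : Matrix ι ι ℝ} (hb : b.det ≠ 0) :
    LinearIndependent ℝ fun i => ∑ s, b⁻¹ i s • k s := by
  rw [Fintype.linearIndependent_iff] at hk ⊢
  intro g hg
  have h1 : ∑ s, (Matrix.vecMul g b⁻¹) s • k s = 0 := by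
    rw [← hg]
    simp only [Finset.smul_sum, smul_smul, Matrix.vecMul, dotProduct, Finset.sum_smul]
    rw [Finset.sum_comm]
  have h2 : Matrix.vecMul g b⁻¹ = 0 := funext (hk _ h1)
  have h3 : (b⁻¹).det ≠ 0 := by
    rw [Matrix.det_nonsing_inv, Ring.inverse_eq_inv']
    exact inv_ne_zero hb
  exact congrFun (Matrix.eq_zero_of_vecMul_eq_zero h3 h2)

theorem functional_dualFamily_mul {c : ι → ℝ} (ha : ∀ i j, K i * K j = ∑ s, a i j s • K s)
    {ε : A →ₗ[ℝ] ℝ} (hε : ∀ s, ε (K s) = c s) (hc : (structureMatrix a c).det ≠ 0) (i j : ι) :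
    ε (dualFamily K (structureMatrix a c) i * K j) = (1 : Matrix ι ι ℝ) i j := by
  simp only [dualFamily, Finset.sum_mul, smul_mul_assoc, map_sum, map_smul,
    functional_mul ha hε, smul_eq_mul]
  rw [← Matrix.mul_apply, Matrix.nonsing_inv_mul _ hc.isUnit]

/-- The dual families of two functionals differ by the factor `∑ c_j T_d^j`. -/
theorem sum_smul_dualFamily_mul (hK : LinearIndependent ℝ K)
    (ha : ∀ i j, K i * K j = ∑ s, a i j s • K s) {c d : ι → ℝ}
    (hc : (structureMatrix a c).det ≠ 0) (hd : (structureMatrix a d).det ≠ 0) (i : ι) :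
    (∑ j, c j • dualFamily K (structureMatrix a d) j) * dualFamily K (structureMatrix a c) i =
      dualFamily K (structureMatrix a d) i := by
  obtain ⟨ε, hε⟩ := exists_functional hK c
  obtain ⟨δ, hδ⟩ := exists_functional hK d
  set P := ∑ j, c j • dualFamily K (structureMatrix a d) j with hP
  have hPS : P ∈ Submodule.span ℝ (Set.range K) :=
    Submodule.sum_mem _ fun j _ => Submodule.smul_mem _ _ (dualFamily_mem_span _ _ _)
  -- Multiplication by `P` converts `δ` into `ε`: on `y = K k`, duality for `d` picks out the
  -- coefficient `c k`.
  have h1 : ∀ y ∈ Submodule.span ℝ (Set.range K), δ (P * y) = ε y := by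
    intro y hy
    induction hy using Submodule.span_induction with
    | mem y hy =>
      obtain ⟨k, rfl⟩ := hy
      simp only [hP, Finset.sum_mul, smul_mul_assoc, map_sum, map_smul,
        functional_dualFamily_mul ha hδ hd, hε, smul_eq_mul, Matrix.one_apply]
      simp
    | zero => simp
    | add x y _ _ hx hy => rw [mul_add, map_add, map_add, hx, hy]
    | smul r x _ hx => rw [mul_smul_comm, map_smul, map_smul, hx]
  rw [← sub_eq_zero]
  have hZ := Submodule.sub_mem _ (mul_mem_span ha hPS (dualFamily_mem_span K (structureMatrix a c) i))
    (dualFamily_mem_span K (structureMatrix a d) i)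
  obtain ⟨z, hz⟩ := (Submodule.mem_span_range_iff_exists_fun ℝ).1 hZ
  -- The difference of the two sides is `δ`-orthogonal to each `K k`, since both pair with `K k` to
  -- the Kronecker symbol. Nondegeneracy of the form of `δ` then makes it zero.
  have h2 : ∀ k, Matrix.vecMul z (structureMatrix a d) k = 0 := by
    intro k
    have h3 : δ ((P * dualFamily K (structureMatrix a c) i - dualFamily K (structureMatrix a d) i) *
        K k) = 0 := by
      rw [sub_mul, map_sub, mul_assoc, h1 _ (mul_mem_span ha (dualFamily_mem_span _ _ _)
        (Submodule.subset_span ⟨k, rfl⟩)), functional_dualFamily_mul ha hε hc,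
        functional_dualFamily_mul ha hδ hd, sub_self]
    rw [← hz] at h3
    simp only [Finset.sum_mul, smul_mul_assoc, map_sum, map_smul, functional_mul ha hδ,
      smul_eq_mul] at h3
    exact h3
  have h4 := Matrix.eq_zero_of_vecMul_eq_zero hd (funext h2)
  rw [← hz, h4]
  simp

/-- Taking both functionals equal, this sum fixes every dual element, hence the whole span, which
contains the unit `K i₀`. -/
theorem sum_smul_dualFamily_self (hK : LinearIndependent ℝ K)
    (ha : ∀ i j, K i * K j = ∑ s, a i j s • K s) {i₀ : ι} (h1 : K i₀ = 1) {d : ι → ℝ}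
    (hd : (structureMatrix a d).det ≠ 0) :
    ∑ j, d j • dualFamily K (structureMatrix a d) j = 1 := by
  have h2 := sum_smul_dualFamily_mul hK ha hd hd
  have h3 : (∑ j, d j • dualFamily K (structureMatrix a d) j) * K i₀ = K i₀ := by
    conv_lhs => rw [← sum_smul_dualFamily K hd i₀]
    rw [Finset.mul_sum]
    simp only [mul_smul_comm, h2]
    exact sum_smul_dualFamily K hd i₀
  rwa [h1, mul_one] at h3

theorem sum_smul_dualFamily_mul_sum (hK : LinearIndependent ℝ K)
    (ha : ∀ i j, K i * K j = ∑ s, a i j s • K s) {i₀ : ι} (h1 : K i₀ = 1) {c d : ι → ℝ}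
    (hc : (structureMatrix a c).det ≠ 0) (hd : (structureMatrix a d).det ≠ 0) :
    (∑ j, c j • dualFamily K (structureMatrix a d) j) *
      (∑ j, d j • dualFamily K (structureMatrix a c) j) = 1 := by
  rw [Finset.mul_sum]
  simp only [mul_smul_comm, sum_smul_dualFamily_mul hK ha hc hd]
  exact sum_smul_dualFamily_self hK ha h1 hd

theorem dualFamily_commute (hK : ∀ i j, K i * K j = K j * K i) (b b' : Matrix ι ι ℝ) (i j : ι) :
    dualFamily K b i * dualFamily K b' j = dualFamily K b' j * dualFamily K b i := by
  change Commute (dualFamily K b i) (dualFamily K b' j)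
  refine Commute.sum_left _ _ _ fun s _ => Commute.sum_right _ _ _ fun t _ => ?_
  exact ((show Commute (K s) (K t) from hK s t).smul_left _).smul_right _

theorem commute_of_commute_dualFamily {b : Matrix ι ι ℝ} (hb : b.det ≠ 0) {x : A}
    (hx : ∀ i, x * dualFamily K b i = dualFamily K b i * x) (k : ι) : x * K k = K k * x := by
  rw [← sum_smul_dualFamily K hb k]
  change Commute x _
  exact Commute.sum_right _ _ _ fun i _ => (show Commute x _ from hx i).smul_right _

end FrobeniusAlgebra

/-! ### Pointwise algebra of commuting Killing tensors -/

section KillingAlgebra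

variable {n : ℕ} [NeZero n] {X : Type*} [AddCommGroup X] [Module ℝ X]

/-- Symmetric contravariant tensors `h s`, the first one with inverse `g`, such that the
operators `h s ∘ g` commute. -/
structure KillingData (h : Fin n → Module.Dual ℝ X →ₗ[ℝ] X) (g : X →ₗ[ℝ] Module.Dual ℝ X) :
    Prop where
  symm : ∀ s (p q : Module.Dual ℝ X), p (h s q) = q (h s p)
  left_inv : ∀ p, g (h 0 p) = p
  right_inv : ∀ v, h 0 (g v) = v
  comm : ∀ s t v, h s (g (h t (g v))) = h t (g (h s (g v)))

variable {h : Fin n → Module.Dual ℝ X →ₗ[ℝ] X} {g : X →ₗ[ℝ] Module.Dual ℝ X}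

theorem KillingData.lower_symm (H : KillingData h g) (u v : X) : g u v = g v u := by
  have := H.symm 0 (g u) (g v)
  rwa [H.right_inv, H.right_inv] at this

theorem KillingData.comm' (H : KillingData h g) (s t : Fin n) (p : Module.Dual ℝ X) :
    h s (g (h t p)) = h t (g (h s p)) := by
  simpa [H.left_inv] using H.comm s t (h 0 p)

theorem KillingData.lower_apply (H : KillingData h g) (s : Fin n) (p : Module.Dual ℝ X) (v : X) :
    g (h s p) v = p (h s (g v)) := by
  rw [H.lower_symm, H.symm]

/-- Operators in the span of the `h s ∘ g` are self-adjoint for all `h t`. -/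
theorem KillingData.adjoint (H : KillingData h g) (s t : Fin n) (p : Module.Dual ℝ X) :
    h s (g (h t p)) = h t (p ∘ₗ (h s ∘ₗ g)) := by
  -- Symmetry of the tensors gives the adjoint action `K_s^* = g h_s`. Commutation of the `K_s` does
  -- the rest.
  have : p ∘ₗ (h s ∘ₗ g) = g (h s p) := by
    ext v
    simp [H.lower_apply]
  rw [this, H.comm']

variable {p : Module.Dual ℝ X}

theorem KillingData.linearIndependent (H : KillingData h g)
    (hp : LinearIndependent ℝ fun s => h s p) :
    LinearIndependent ℝ fun s => (h s ∘ₗ g : Module.End ℝ X) := by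
  have h1 : (fun s => h s p) = (LinearMap.applyₗ (h 0 p) : Module.End ℝ X →ₗ[ℝ] X) ∘
      fun s => (h s ∘ₗ g : Module.End ℝ X) := by
    ext s
    simp [H.left_inv]
  rw [h1] at hp
  exact hp.of_comp _

/-- The vector `h 0 p` is cyclic, as `K_s` sends it to `h s p`. Expanding `T (h 0 p)` in these
vectors fixes the coefficients, and commutation with `K_t` propagates the expansion to every `h t
p`. -/
theorem KillingData.mem_span_of_commute (H : KillingData h g)
    (hspan : Submodule.span ℝ (Set.range fun s => h s p) = ⊤) {T : Module.End ℝ X}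
    (hT : ∀ s, T * (h s ∘ₗ g) = (h s ∘ₗ g) * T) :
    ∃ c : Fin n → ℝ, T = ∑ s, c s • (h s ∘ₗ g : Module.End ℝ X) := by
  have hmem : T (h 0 p) ∈ Submodule.span ℝ (Set.range fun s => h s p) := by rw [hspan]; trivial
  obtain ⟨c, hc⟩ := (Submodule.mem_span_range_iff_exists_fun ℝ).1 hmem
  refine ⟨c, LinearMap.ext_on_range hspan fun t => ?_⟩
  have h1 := congrArg (fun A : Module.End ℝ X => A (h 0 p)) (hT t)
  simp only [Module.End.mul_apply, LinearMap.comp_apply, H.left_inv] at h1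
  rw [h1, ← hc]
  simp only [map_sum, map_smul, LinearMap.sum_apply, LinearMap.smul_apply, LinearMap.comp_apply]
  exact Finset.sum_congr rfl fun s _ => by rw [H.comm']

theorem KillingData.eq_zero_of_apply_eq_zero (H : KillingData h g)
    (hspan : Submodule.span ℝ (Set.range fun s => h s p) = ⊤) {v : X}
    (hv : ∀ s, p (h s (g v)) = 0) : v = 0 := by
  have h1 : g v = 0 := by
    refine LinearMap.ext_on_range hspan fun s => ?_
    rw [H.symm s (g v) p]
    simpa using hv s
  rw [← H.right_inv v, h1, map_zero]

theorem KillingData.linearIndependent_comp (H : KillingData h g)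
    (hp : LinearIndependent ℝ fun s => h s p) :
    LinearIndependent ℝ fun s => p ∘ₗ (h s ∘ₗ g) := by
  have h1 : (fun s => p ∘ₗ (h s ∘ₗ g)) = g ∘ fun s => h s p := by
    ext s v
    simp [H.lower_apply]
  rw [h1]
  exact hp.map' g (LinearMap.ker_eq_bot_of_injective (Function.LeftInverse.injective H.right_inv))

/-- The matrix `g(ξ_i, ξ_j)`, `ξ_s = 2 h_s(p)`. -/
def velocityMatrix (h : Fin n → Module.Dual ℝ X →ₗ[ℝ] X) (g : X →ₗ[ℝ] Module.Dual ℝ X)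
    (p : Module.Dual ℝ X) : Matrix (Fin n) (Fin n) ℝ :=
  Matrix.of fun i j => g ((2 : ℝ) • h i p) ((2 : ℝ) • h j p)

theorem KillingData.velocityMatrix_apply (H : KillingData h g) (i j : Fin n) :
    velocityMatrix h g p i j = 4 * p (h i (g (h j p))) := by
  simp [velocityMatrix, H.lower_apply]
  ring

/-- The entry is `4 p(K_i K_j (h 0 p))`, and expanding the product leaves only the values `p (h s
p)`. These are constant along a level, so the metric along a level is a Frobenius form with constant
coefficients. -/
theorem KillingData.velocityMatrix_eq (H : KillingData h g) {a : Fin n → Fin n → Fin n → ℝ}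
    (ha : ∀ i j, (h i ∘ₗ g : Module.End ℝ X) * (h j ∘ₗ g) =
      ∑ s, a i j s • (h s ∘ₗ g : Module.End ℝ X)) :
    velocityMatrix h g p = structureMatrix a fun s => 4 * p (h s p) := by
  ext i j
  have h1 := congrArg (fun A : Module.End ℝ X => p (A (h 0 p))) (ha i j)
  simp only [Module.End.mul_apply, LinearMap.comp_apply, H.left_inv, LinearMap.sum_apply,
    LinearMap.smul_apply, map_sum, map_smul, smul_eq_mul] at h1
  rw [H.velocityMatrix_apply, h1, structureMatrix, Matrix.of_apply, Finset.mul_sum]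
  exact Finset.sum_congr rfl fun s _ => by ring

/-- A kernel vector `x` yields `v = ∑ x s • h s p` annihilated by all `p ∘ K_i`. These covectors
separate vectors, so `v = 0`, and then `x = 0` by independence. -/
theorem KillingData.det_velocityMatrix_ne_zero (H : KillingData h g)
    (hp : LinearIndependent ℝ fun s => h s p)
    (hspan : Submodule.span ℝ (Set.range fun s => h s p) = ⊤) :
    (velocityMatrix h g p).det ≠ 0 := by
  intro h0
  obtain ⟨x, hx, hxb⟩ := Matrix.exists_mulVec_eq_zero_iff.2 h0
  apply hx
  rw [Fintype.linearIndependent_iff] at hp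
  refine funext (hp x (H.eq_zero_of_apply_eq_zero hspan fun i => ?_))
  have h1 := congrFun hxb i
  simp only [Matrix.mulVec, dotProduct, H.velocityMatrix_apply, Pi.zero_apply] at h1
  have h2 : 4 * p (h i (g (∑ s, x s • h s p))) = 0 := by
    rw [← h1]
    simp only [map_sum, map_smul, smul_eq_mul, Finset.mul_sum]
    exact Finset.sum_congr rfl fun s _ => by ring
  linarith

/-- Duality in the form needed for deformations: along a level these numbers do not depend on the
point. The 4 comes from `ξ_s = 2 h_s(p)`. -/
theorem KillingData.apply_dualFamily (H : KillingData h g) (hb : (velocityMatrix h g p).det ≠ 0)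
    (i s : Fin n) :
    p (dualFamily (fun s => (h s ∘ₗ g : Module.End ℝ X)) (velocityMatrix h g p) i (h s p)) =
      (1 : Matrix (Fin n) (Fin n) ℝ) i s / 4 := by
  have h1 : ∀ k, p (h k (g (h s p))) = velocityMatrix h g p k s / 4 := fun k => by
    rw [H.velocityMatrix_apply]; ring
  simp only [dualFamily, LinearMap.sum_apply, LinearMap.smul_apply, LinearMap.comp_apply, map_sum,
    map_smul, smul_eq_mul, h1, mul_div_assoc']
  rw [← Finset.sum_div, ← Matrix.mul_apply, Matrix.nonsing_inv_mul _ hb.isUnit]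

theorem KillingData.adjoint_dualFamily (H : KillingData h g) (b : Matrix (Fin n) (Fin n) ℝ)
    (i t : Fin n) (q : Module.Dual ℝ X) :
    dualFamily (fun s => (h s ∘ₗ g : Module.End ℝ X)) b i (h t q) =
      h t (q ∘ₗ dualFamily (fun s => (h s ∘ₗ g : Module.End ℝ X)) b i) := by
  have h1 : q ∘ₗ dualFamily (fun s => (h s ∘ₗ g : Module.End ℝ X)) b i =
      ∑ s, b⁻¹ i s • q ∘ₗ (h s ∘ₗ g) := by
    ext v
    simp [dualFamily]
  rw [h1]
  simp only [dualFamily, LinearMap.sum_apply, LinearMap.smul_apply, LinearMap.comp_apply, map_sum,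
    map_smul]
  exact Finset.sum_congr rfl fun s _ => by rw [H.adjoint]

end KillingAlgebra

/-! ### Tensor fields in a chart -/

section Charts

/-- The space of coordinates. -/
abbrev Coords (n : ℕ) : Type := EuclideanSpace ℝ (Fin n)

variable {n : ℕ} {M : Type*} [TopologicalSpace M] [ChartedSpace (Coords n) M]
  (φ : OpenPartialHomeomorph M (Coords n))

/-- The components of tangent vectors at `φ.symm y` in the chart `φ`. -/
def toCoords (y : Coords n) : TangentSpace (𝓡 n) (φ.symm y) →L[ℝ] Coords n :=
  mvfderiv (𝓡 n) φ (φ.symm y)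

/-- The tangent vector at `φ.symm y` with given components in the chart `φ`. -/
def ofCoords (y : Coords n) : Coords n →L[ℝ] TangentSpace (𝓡 n) (φ.symm y) :=
  (mfderiv (𝓡 n) (𝓡 n) φ.symm y) ∘L
    (NormedSpace.fromTangentSpace (𝕜 := ℝ) y).symm.toContinuousLinearMap

/-- A vector field in coordinates. -/
def vecHat (ξ : ∀ x : M, TangentSpace (𝓡 n) x) (y : Coords n) : Coords n :=
  toCoords φ y (ξ (φ.symm y))

/-- An operator field in coordinates. -/
def opHat (L : OpField n M) (y : Coords n) : Coords n →L[ℝ] Coords n :=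
  LinearMap.toContinuousLinearMap
    ((toCoords φ y).toLinearMap ∘ₗ L (φ.symm y) ∘ₗ (ofCoords φ y).toLinearMap)

/-- A differential form in coordinates. -/
def formHat (α : OneForm n M) (y : Coords n) : Coords n →L[ℝ] ℝ :=
  LinearMap.toContinuousLinearMap (α (φ.symm y) ∘ₗ (ofCoords φ y).toLinearMap)

/-- The covector at `φ.symm y` with given components. -/
def pullCovector (y : Coords n) : (Coords n →L[ℝ] ℝ) →ₗ[ℝ] Cotangent n (φ.symm y) where
  toFun p := p.toLinearMap ∘ₗ (toCoords φ y).toLinearMap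
  map_add' _ _ := rfl
  map_smul' _ _ := rfl

/-- A contravariant tensor field in coordinates. -/
def coHat (h : CoTensor n M) (y : Coords n) : (Coords n →L[ℝ] ℝ) →L[ℝ] Coords n :=
  LinearMap.toContinuousLinearMap
    ((toCoords φ y).toLinearMap ∘ₗ h (φ.symm y) ∘ₗ pullCovector φ y)

variable {φ}

theorem opHat_apply (L : OpField n M) (y v : Coords n) :
    opHat φ L y v = toCoords φ y (L (φ.symm y) (ofCoords φ y v)) := rfl

theorem formHat_apply (α : OneForm n M) (y v : Coords n) :
    formHat φ α y v = α (φ.symm y) (ofCoords φ y v) := rfl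

theorem coHat_apply (h : CoTensor n M) (y : Coords n) (p : Coords n →L[ℝ] ℝ) :
    coHat φ h y p = toCoords φ y (h (φ.symm y) (pullCovector φ y p)) := rfl

theorem pullCovector_apply (y : Coords n) (p : Coords n →L[ℝ] ℝ)
    (v : TangentSpace (𝓡 n) (φ.symm y)) : pullCovector φ y p v = p (toCoords φ y v) := rfl

section Inverse

variable (hφ : φ ∈ IsManifold.maximalAtlas (𝓡 n) ∞ M) {y : Coords n} (hy : y ∈ φ.target)

include hφ

theorem mdifferentiable_of_mem_maximalAtlas : φ.MDifferentiable (𝓡 n) (𝓡 n) :=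
  ⟨(contMDiffOn_of_mem_maximalAtlas hφ).mdifferentiableOn (by simp),
    (contMDiffOn_symm_of_mem_maximalAtlas hφ).mdifferentiableOn (by simp)⟩

include hy

theorem toCoords_ofCoords (v : Coords n) : toCoords φ y (ofCoords φ y v) = v := by
  have h1 := (mdifferentiable_of_mem_maximalAtlas hφ).comp_symm_deriv hy
  exact congrArg (fun A => A v) h1

theorem ofCoords_toCoords (v : TangentSpace (𝓡 n) (φ.symm y)) :
    ofCoords φ y (toCoords φ y v) = v := by
  have h1 := (mdifferentiable_of_mem_maximalAtlas hφ).symm_comp_deriv (φ.map_target hy)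
  have h2 : mfderiv (𝓡 n) (𝓡 n) φ.symm (φ (φ.symm y)) = mfderiv (𝓡 n) (𝓡 n) φ.symm y := by
    rw [φ.right_inv hy]
  rw [h2] at h1
  exact congrArg (fun A => A v) h1

theorem pullCovector_formHat (α : OneForm n M) : pullCovector φ y (formHat φ α y) = α (φ.symm y) := by
  ext v
  rw [pullCovector_apply, formHat_apply, ofCoords_toCoords hφ hy]

theorem opHat_toCoords (L : OpField n M) (v : TangentSpace (𝓡 n) (φ.symm y)) :
    opHat φ L y (toCoords φ y v) = toCoords φ y (L (φ.symm y) v) := by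
  rw [opHat_apply, ofCoords_toCoords hφ hy]

theorem opHat_vecHat (L : OpField n M) (ξ : ∀ x : M, TangentSpace (𝓡 n) x) :
    opHat φ L y (vecHat φ ξ y) = vecHat φ (fun x => L x (ξ x)) y :=
  opHat_toCoords hφ hy L _

theorem formHat_toCoords (α : OneForm n M) (v : TangentSpace (𝓡 n) (φ.symm y)) :
    formHat φ α y (toCoords φ y v) = α (φ.symm y) v := by
  rw [formHat_apply, ofCoords_toCoords hφ hy]

theorem toCoords_injective : Function.Injective (toCoords φ y) :=
  Function.LeftInverse.injective (ofCoords_toCoords hφ hy)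

theorem toCoords_surjective : Function.Surjective (toCoords φ y) :=
  Function.RightInverse.surjective (toCoords_ofCoords hφ hy)

theorem opHat_mul (L N : OpField n M) :
    opHat φ L y * opHat φ N y = opHat φ (fun x => L x * N x) y := by
  ext1 v
  change opHat φ L y (opHat φ N y v) = _
  rw [opHat_apply N, opHat_toCoords hφ hy]
  rfl

theorem coHat_formHat (h : CoTensor n M) (α : OneForm n M) :
    coHat φ h y (formHat φ α y) = toCoords φ y (h (φ.symm y) (α (φ.symm y))) := by
  rw [coHat_apply, pullCovector_formHat hφ hy]

end Inverse

theorem coHat_symm {h : CoTensor n M} (hh : SymmCoTensor h) (y : Coords n)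
    (p q : Coords n →L[ℝ] ℝ) : p (coHat φ h y q) = q (coHat φ h y p) :=
  hh (φ.symm y) (pullCovector φ y p) (pullCovector φ y q)

section Smoothness

theorem sum_smul_single (v : Coords n) : ∑ j, v j • EuclideanSpace.single j (1 : ℝ) = v := by
  ext i
  simp [Pi.single_apply]

theorem contDiffOn_clm_iff {F : Type*} [NormedAddCommGroup F] [NormedSpace ℝ F]
    {A : Coords n → Coords n →L[ℝ] F} {W : Set (Coords n)} :
    ContDiffOn ℝ ∞ A W ↔
      ∀ j, ContDiffOn ℝ ∞ (fun y => A y (EuclideanSpace.single j 1)) W := by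
  rw [contDiffOn_clm_apply]
  refine ⟨fun h j => h _, fun h v => ?_⟩
  have h1 : (fun y => A y v) = fun y => ∑ j, v j • A y (EuclideanSpace.single j 1) := by
    funext y
    conv_lhs => rw [← sum_smul_single v]
    simp only [map_sum, map_smul]
  rw [h1]
  exact ContDiffOn.sum fun j _ => (h j).const_smul _

theorem sum_smul_proj (p : Coords n →L[ℝ] ℝ) :
    ∑ i, p (EuclideanSpace.single i 1) • (EuclideanSpace.proj i : Coords n →L[ℝ] ℝ) = p := by
  ext v
  conv_rhs => rw [← sum_smul_single v]
  simp [mul_comm]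

theorem contDiffOn_clm_dual_iff {F : Type*} [NormedAddCommGroup F] [NormedSpace ℝ F]
    {A : Coords n → (Coords n →L[ℝ] ℝ) →L[ℝ] F} {W : Set (Coords n)} :
    ContDiffOn ℝ ∞ A W ↔
      ∀ j, ContDiffOn ℝ ∞ (fun y => A y (EuclideanSpace.proj j : Coords n →L[ℝ] ℝ)) W := by
  rw [contDiffOn_clm_apply]
  refine ⟨fun h j => h _, fun h p => ?_⟩
  have h1 : (fun y => A y p) = fun y => ∑ j, p (EuclideanSpace.single j 1) •
      A y (EuclideanSpace.proj j : Coords n →L[ℝ] ℝ) := by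
    funext y
    conv_lhs => rw [← sum_smul_proj p]
    simp only [map_sum, map_smul]
  rw [h1]
  exact ContDiffOn.sum fun j _ => (h j).const_smul _

theorem smoothOpOn_iff {U : Set M} {L : OpField n M} :
    SmoothOpOn U L ↔ ∀ φ ∈ IsManifold.maximalAtlas (𝓡 n) ∞ M,
      ContDiffOn ℝ ∞ (opHat φ L) (φ.target ∩ φ.symm ⁻¹' U) := by
  simp only [contDiffOn_clm_iff, contDiffOn_euclidean]
  exact ⟨fun h φ hφ j i => h φ hφ i j, fun h φ hφ i j => h φ hφ j i⟩

theorem smoothFormOn_iff {U : Set M} {α : OneForm n M} :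
    SmoothFormOn U α ↔ ∀ φ ∈ IsManifold.maximalAtlas (𝓡 n) ∞ M,
      ContDiffOn ℝ ∞ (formHat φ α) (φ.target ∩ φ.symm ⁻¹' U) := by
  simp only [contDiffOn_clm_iff]
  rfl

theorem SmoothCoTensor.contDiffOn {h : CoTensor n M} (hh : SmoothCoTensor h)
    (hφ : φ ∈ IsManifold.maximalAtlas (𝓡 n) ∞ M) : ContDiffOn ℝ ∞ (coHat φ h) φ.target := by
  simp only [contDiffOn_clm_dual_iff, contDiffOn_euclidean]
  exact fun j i => hh φ hφ i j

end Smoothness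

/-! ### The Poisson bracket in canonical coordinates -/

section PoissonCoords

/-- The covector with components `p i`. -/
def covectorOf (p : Fin n → ℝ) : Coords n →L[ℝ] ℝ :=
  ∑ i, p i • (EuclideanSpace.proj i : Coords n →L[ℝ] ℝ)

theorem covectorOf_single (i : Fin n) :
    covectorOf (Pi.single i 1) = (EuclideanSpace.proj i : Coords n →L[ℝ] ℝ) := by
  simp [covectorOf, Pi.single_apply]

/-- `covectorOf` as a continuous linear map. -/
def covectorOfL (n : ℕ) : (Fin n → ℝ) →L[ℝ] Coords n →L[ℝ] ℝ :=
  ∑ i, (ContinuousLinearMap.proj i : (Fin n → ℝ) →L[ℝ] ℝ).smulRight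
    (EuclideanSpace.proj i : Coords n →L[ℝ] ℝ)

theorem covectorOfL_apply (p : Fin n → ℝ) : covectorOfL n p = covectorOf p := by
  simp [covectorOfL, covectorOf]

theorem inCoords_quadFun (h : CoTensor n M) (z : Coords n × (Fin n → ℝ)) :
    inCoords φ (quadFun h) z = covectorOfL n z.2 (coHat φ h z.1 (covectorOfL n z.2)) := by
  have h1 : ∑ i, z.2 i • coordCovector φ (φ.symm z.1) i =
      pullCovector φ z.1 (covectorOfL n z.2) := by
    rw [covectorOfL_apply, covectorOf, map_sum]
    exact Finset.sum_congr rfl fun i _ => by rw [map_smul]; rfl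
  rw [inCoords, h1]
  rfl

/-- The parameter `c` allows two uses: component vectors for the partial derivatives, and, with `c`
the identity, covectors themselves for the moment map. -/
theorem hasFDerivAt_quadratic {V P : Type*} [NormedAddCommGroup V] [NormedSpace ℝ V]
    [NormedAddCommGroup P] [NormedSpace ℝ P] (c : P →L[ℝ] V →L[ℝ] ℝ)
    {k : V → (V →L[ℝ] ℝ) →L[ℝ] V} {y : V} (hk : DifferentiableAt ℝ k y) (p : P) :
    ∃ D : (V × P) →L[ℝ] ℝ,
      HasFDerivAt (fun z : V × P => c z.2 (k z.1 (c z.2))) D (y, p) ∧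
      ∀ u q, D (u, q) = c q (k y (c p)) + (c p (fderiv ℝ k y u (c p)) + c p (k y (c q))) := by
  have h1 : HasFDerivAt (fun z : V × P => c z.2) (c ∘L ContinuousLinearMap.snd ℝ _ _) (y, p) :=
    c.hasFDerivAt.comp (y, p) hasFDerivAt_snd
  have hk' : HasFDerivAt k (fderiv ℝ k y) (Prod.fst (y, p)) := hk.hasFDerivAt
  have hfst : HasFDerivAt (Prod.fst : V × P → V) (ContinuousLinearMap.fst ℝ V P) (y, p) :=
    hasFDerivAt_fst
  have h2 := HasFDerivAt.comp (G := (V →L[ℝ] ℝ) →L[ℝ] V) (y, p) hk' hfst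
  refine ⟨_, h1.clm_apply (h2.clm_apply h1), fun u q => ?_⟩
  simp
  ring

variable {h : CoTensor n M}

theorem partialU_quadFun (hφ : φ ∈ IsManifold.maximalAtlas (𝓡 n) ∞ M) (hh : SmoothCoTensor h)
    {y : Coords n} (hy : y ∈ φ.target) (p : Fin n → ℝ) (i : Fin n) :
    partialU (inCoords φ (quadFun h)) i (y, p) =
      covectorOf p (fderiv ℝ (coHat φ h) y (EuclideanSpace.single i 1) (covectorOf p)) := by
  obtain ⟨D, hD, hDa⟩ := hasFDerivAt_quadratic (covectorOfL n) (((hh.contDiffOn hφ).differentiableOn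
    (by simp)).differentiableAt (φ.open_target.mem_nhds hy)) p
  rw [partialU, funext (inCoords_quadFun h), hD.fderiv, hDa, map_zero]
  simp [covectorOfL_apply]

theorem partialP_quadFun (hφ : φ ∈ IsManifold.maximalAtlas (𝓡 n) ∞ M) (hh : SmoothCoTensor h)
    (hsymm : SymmCoTensor h) {y : Coords n} (hy : y ∈ φ.target) (p : Fin n → ℝ) (i : Fin n) :
    partialP (inCoords φ (quadFun h)) i (y, p) = 2 * coHat φ h y (covectorOf p) i := by
  obtain ⟨D, hD, hDa⟩ := hasFDerivAt_quadratic (covectorOfL n) (((hh.contDiffOn hφ).differentiableOn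
    (by simp)).differentiableAt (φ.open_target.mem_nhds hy)) p
  rw [partialP, funext (inCoords_quadFun h), hD.fderiv, hDa,
    coHat_symm hsymm y (covectorOfL n p)]
  simp only [covectorOfL_apply, covectorOf_single]
  simp
  ring

theorem PoissonCommute.poissonAt {k : CoTensor n M} (hφ : φ ∈ IsManifold.maximalAtlas (𝓡 n) ∞ M)
    (hh : SmoothCoTensor h) (hk : SmoothCoTensor k) (hhs : SymmCoTensor h) (hks : SymmCoTensor k)
    (hc : PoissonCommute (quadFun h) (quadFun k)) {y : Coords n} (hy : y ∈ φ.target) :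
    PoissonAt (coHat φ h) (coHat φ k) y := by
  intro p
  have h1 := hc φ hφ y hy fun i => p (EuclideanSpace.single i 1)
  simp only [partialP_quadFun hφ hh hhs hy, partialP_quadFun hφ hk hks hy,
    partialU_quadFun hφ hh hy, partialU_quadFun hφ hk hy] at h1
  have hp : covectorOf (fun i => p (EuclideanSpace.single i 1)) = p := sum_smul_proj p
  rw [hp] at h1
  have h2 : ∀ (A : Coords n →L[ℝ] (Coords n →L[ℝ] ℝ) →L[ℝ] Coords n) (v : Coords n),
      p (A v p) = ∑ i, v i * p (A (EuclideanSpace.single i 1) p) := by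
    intro A v
    conv_lhs => rw [← sum_smul_single v]
    simp
  rw [h2 _ (coHat φ h y p), h2 _ (coHat φ k y p)]
  rw [Finset.sum_sub_distrib] at h1
  simp only [mul_assoc, mul_comm (p _) (2 * _), ← Finset.mul_sum] at h1
  linarith

end PoissonCoords

end Charts

/-! ### Vector fields and Lie brackets in the preferred chart -/

section VectorFields

variable {n : ℕ} {M : Type*} [TopologicalSpace M] [ChartedSpace (Coords n) M]

theorem contMDiffAt_iff_comp_symm {F : Type*} [NormedAddCommGroup F] [NormedSpace ℝ F]
    {φ : OpenPartialHomeomorph M (Coords n)} (hφ : φ ∈ IsManifold.maximalAtlas (𝓡 n) ∞ M)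
    {f : M → F} {x : M} (hx : x ∈ φ.source) :
    ContMDiffAt (𝓡 n) 𝓘(ℝ, F) ∞ f x ↔ ContDiffAt ℝ ∞ (fun y => f (φ.symm y)) (φ x) := by
  rw [← contMDiffAt_iff_contDiffAt]
  have h1 : ContMDiffAt (𝓡 n) (𝓡 n) ∞ φ x :=
    (contMDiffOn_of_mem_maximalAtlas hφ).contMDiffAt (φ.open_source.mem_nhds hx)
  have h2 : ContMDiffAt (𝓡 n) (𝓡 n) ∞ φ.symm (φ x) :=
    (contMDiffOn_symm_of_mem_maximalAtlas hφ).contMDiffAt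
      (φ.open_target.mem_nhds (φ.map_source hx))
  constructor
  · intro hf
    rw [← φ.left_inv hx] at hf
    exact hf.comp (φ x) h2
  · intro hf
    refine (hf.comp x h1).congr_of_eventuallyEq ?_
    filter_upwards [φ.open_source.mem_nhds hx] with z hz
    simp [φ.left_inv hz]

theorem coe_extChartAt_model (x : M) :
    (extChartAt (𝓡 n) x : M → Coords n) = chartAt (Coords n) x := rfl

theorem coe_extChartAt_model_symm (x : M) :
    ((extChartAt (𝓡 n) x).symm : Coords n → M) = (chartAt (Coords n) x).symm := rfl

theorem lieBracketWithin_univ_congr {A B A' B' : Coords n → Coords n} {y : Coords n}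
    (hA : A =ᶠ[nhds y] A') (hB : B =ᶠ[nhds y] B') :
    VectorField.lieBracketWithin ℝ A B Set.univ y = VectorField.lieBracket ℝ A' B' y := by
  rw [VectorField.lieBracketWithin_univ, hA.lieBracket_vectorField_eq hB]

variable [IsManifold (𝓡 n) ∞ M]

/-- On the chart domain the tangent bundle trivialization at `x` is the derivative of the preferred
chart, so its fibre component is the coordinate expression of `ξ`. -/
theorem contMDiffAt_section_iff {ξ : ∀ x : M, TangentSpace (𝓡 n) x} {x : M} :
    ContMDiffAt (𝓡 n) (𝓡 n).tangent ∞ (fun x => (⟨x, ξ x⟩ : TangentBundle (𝓡 n) M)) x ↔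
      ContDiffAt ℝ ∞ (vecHat (chartAt (Coords n) x) ξ) (chartAt (Coords n) x x) := by
  have : IsManifold (𝓡 n) 1 M := IsManifold.of_le (n := ∞) (by simp)
  rw [Bundle.contMDiffAt_section]
  have h1 : (fun z => (trivializationAt (Coords n) (TangentSpace (𝓡 n)) x ⟨z, ξ z⟩).2) =ᶠ[nhds x]
      fun z => mvfderiv (𝓡 n) (chartAt (Coords n) x) z (ξ z) := by
    filter_upwards [(chartAt (Coords n) x).open_source.mem_nhds (mem_chart_source _ x)] with z hz
    have h2 := TangentBundle.continuousLinearMapAt_trivializationAt (I := 𝓡 n) hz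
    have h3 := congrArg (fun A => A (ξ z)) h2
    simp only [Bundle.Trivialization.continuousLinearMapAt_apply] at h3
    rw [Bundle.Trivialization.coe_linearMapAt_of_mem] at h3
    · exact h3
    · simpa using hz
  rw [Filter.EventuallyEq.contMDiffAt_iff h1]
  exact contMDiffAt_iff_comp_symm (IsManifold.chart_mem_maximalAtlas x) (mem_chart_source _ x)

theorem smoothVecOn_iff {U : Set M} (hU : IsOpen U) {ξ : ∀ x : M, TangentSpace (𝓡 n) x} :
    SmoothVecOn U ξ ↔ ∀ x ∈ U,
      ContDiffAt ℝ ∞ (vecHat (chartAt (Coords n) x) ξ) (chartAt (Coords n) x x) := by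
  refine ⟨fun h x hx => contMDiffAt_section_iff.1 (h.contMDiffAt (hU.mem_nhds hx)), fun h x hx => ?_⟩
  exact (contMDiffAt_section_iff.2 (h x hx)).contMDiffWithinAt

theorem SmoothOpOn.contDiffAt {U : Set M} (hU : IsOpen U) {L : OpField n M} (hL : SmoothOpOn U L)
    {x : M} (hx : x ∈ U) : ContDiffAt ℝ ∞ (opHat (chartAt (Coords n) x) L) (chartAt (Coords n) x x) := by
  have hφ := IsManifold.chart_mem_maximalAtlas (I := 𝓡 n) (n := ∞) x
  refine ((smoothOpOn_iff.1 hL) _ hφ).contDiffAt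
    (((chartAt (Coords n) x).symm.isOpen_inter_preimage hU).mem_nhds ⟨mem_chart_target _ x, ?_⟩)
  simpa using hx

theorem eventually_vecHat_apply (L : OpField n M) (ξ : ∀ x : M, TangentSpace (𝓡 n) x) (x : M) :
    vecHat (chartAt (Coords n) x) (fun z => L z (ξ z)) =ᶠ[nhds (chartAt (Coords n) x x)]
      fun y => opHat (chartAt (Coords n) x) L y (vecHat (chartAt (Coords n) x) ξ y) := by
  filter_upwards [(chartAt (Coords n) x).open_target.mem_nhds (mem_chart_target _ x)] with y hy
  exact (opHat_vecHat (IsManifold.chart_mem_maximalAtlas x) hy L ξ).symm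

theorem SmoothOpOn.smoothVecOn {U : Set M} (hU : IsOpen U) {L : OpField n M} (hL : SmoothOpOn U L)
    {ξ : ∀ x : M, TangentSpace (𝓡 n) x} (hξ : SmoothVecOn U ξ) :
    SmoothVecOn U (fun z => L z (ξ z)) := by
  rw [smoothVecOn_iff hU] at hξ ⊢
  intro x hx
  exact ((hL.contDiffAt hU hx).clm_apply (hξ x hx)).congr_of_eventuallyEq
    (eventually_vecHat_apply L ξ x)

open VectorField

/-- Pulling back along the inverse chart applies the inverse of its derivative, which is the
derivative of the chart. -/
theorem mpullbackWithin_eq_vecHat (ξ : ∀ x : M, TangentSpace (𝓡 n) x) (x : M) {y : Coords n}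
    (hy : y ∈ (chartAt (Coords n) x).target) :
    mpullbackWithin 𝓘(ℝ, Coords n) (𝓡 n) (extChartAt (𝓡 n) x).symm ξ (Set.range (𝓡 n)) y =
      vecHat (chartAt (Coords n) x) ξ y := by
  have hφ := IsManifold.chart_mem_maximalAtlas (I := 𝓡 n) (n := ∞) x
  have h1 := mdifferentiable_of_mem_maximalAtlas hφ
  rw [coe_extChartAt_model_symm, ModelWithCorners.range_eq_univ, mpullbackWithin_univ, mpullback_apply]
  have h2 := h1.symm_comp_deriv ((chartAt (Coords n) x).map_target hy)
  rw [(chartAt (Coords n) x).right_inv hy] at h2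
  rw [ContinuousLinearMap.inverse_eq h2 (h1.comp_symm_deriv hy)]
  rfl

theorem toCoords_mlieBracket (ξ η : ∀ x : M, TangentSpace (𝓡 n) x) (x : M) :
    mvfderiv (𝓡 n) (chartAt (Coords n) x) x (mlieBracket (𝓡 n) ξ η x) =
      lieBracket ℝ (vecHat (chartAt (Coords n) x) ξ) (vecHat (chartAt (Coords n) x) η)
        (chartAt (Coords n) x x) := by
  have hφ := IsManifold.chart_mem_maximalAtlas (I := 𝓡 n) (n := ∞) x
  have h1 := mdifferentiable_of_mem_maximalAtlas hφ
  have h2 : ∀ ξ : ∀ x : M, TangentSpace (𝓡 n) x,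
      mpullbackWithin 𝓘(ℝ, Coords n) (𝓡 n) (extChartAt (𝓡 n) x).symm ξ (Set.range (𝓡 n))
        =ᶠ[nhds (chartAt (Coords n) x x)] vecHat (chartAt (Coords n) x) ξ := by
    intro ξ
    filter_upwards [(chartAt (Coords n) x).open_target.mem_nhds (mem_chart_target _ x)] with y hy
    exact mpullbackWithin_eq_vecHat ξ x hy
  have h3 := h1.symm_comp_deriv (mem_chart_source _ x)
  have h4 := h1.comp_symm_deriv (mem_chart_target _ x)
  rw [(chartAt (Coords n) x).left_inv (mem_chart_source _ x)] at h4
  have h6 : ∀ w : TangentSpace (𝓡 n) (chartAt (Coords n) x x), mvfderiv (𝓡 n) (chartAt (Coords n) x) x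
      (mfderiv (𝓡 n) (𝓡 n) (chartAt (Coords n) x).symm (chartAt (Coords n) x x) w) = w :=
    fun w => congrArg (fun A => A w) h4
  have h5 : (extChartAt (𝓡 n) x).symm ⁻¹' Set.univ ∩ Set.range (𝓡 n) = Set.univ := by
    rw [ModelWithCorners.range_eq_univ, Set.preimage_univ, Set.univ_inter]
  rw [← mlieBracketWithin_univ, mlieBracketWithin_apply, coe_extChartAt_model,
    ContinuousLinearMap.inverse_eq h4 h3, h5]
  refine (h6 _).trans ?_
  exact lieBracketWithin_univ_congr (h2 ξ) (h2 η)

end VectorFields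

/-! ### Calculus of the bracket of operator fields -/

section Brackets

variable {n : ℕ} {M : Type*} [TopologicalSpace M] [ChartedSpace (Coords n) M]

theorem opHat_mvfderiv {φ : OpenPartialHomeomorph M (Coords n)}
    (hφ : φ ∈ IsManifold.maximalAtlas (𝓡 n) ∞ M) {x : M} (hx : x ∈ φ.source) (L : OpField n M)
    (v : TangentSpace (𝓡 n) x) :
    opHat φ L (φ x) (mvfderiv (𝓡 n) φ x v) = mvfderiv (𝓡 n) φ x (L x v) := by
  have h1 : ∀ (y : Coords n) (z : M), y ∈ φ.target → z = φ.symm y → ∀ v : TangentSpace (𝓡 n) z,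
      opHat φ L y (mvfderiv (𝓡 n) φ z v) = mvfderiv (𝓡 n) φ z (L z v) := by
    rintro y z hy rfl v
    exact opHat_toCoords hφ hy L v
  exact h1 (φ x) x (φ.map_source hx) (φ.left_inv hx).symm v

theorem mvfderiv_injective {φ : OpenPartialHomeomorph M (Coords n)}
    (hφ : φ ∈ IsManifold.maximalAtlas (𝓡 n) ∞ M) {x : M} (hx : x ∈ φ.source) :
    Function.Injective (mvfderiv (𝓡 n) φ x) := by
  have h1 : ∀ (y : Coords n) (z : M), y ∈ φ.target → z = φ.symm y →
      Function.Injective (mvfderiv (𝓡 n) φ z) := by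
    rintro y z hy rfl
    exact toCoords_injective hφ hy
  exact h1 (φ x) x (φ.map_source hx) (φ.left_inv hx).symm

open VectorField

theorem opBracket_congr {L L' N N' : OpField n M} {x : M} (hL : ∀ᶠ z in nhds x, L z = L' z)
    (hN : ∀ᶠ z in nhds x, N z = N' z) (ξ η : ∀ x : M, TangentSpace (𝓡 n) x) :
    opBracket L N ξ η x = opBracket L' N' ξ η x := by
  have h1 : (fun z => L z (ξ z)) =ᶠ[nhds x] fun z => L' z (ξ z) := by
    filter_upwards [hL] with z hz
    rw [hz]
  have h2 : (fun z => N z (η z)) =ᶠ[nhds x] fun z => N' z (η z) := by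
    filter_upwards [hN] with z hz
    rw [hz]
  have r : ∀ ξ : ∀ x : M, TangentSpace (𝓡 n) x, ξ =ᶠ[nhds x] ξ := fun _ => Filter.EventuallyEq.rfl
  rw [opBracket, opBracket, h1.mlieBracket_vectorField_eq h2,
    (r ξ).mlieBracket_vectorField_eq h2, h1.mlieBracket_vectorField_eq (r η), hL.self_of_nhds,
    hN.self_of_nhds]

theorem smoothOpOn_add {U : Set M} {L N : OpField n M} (hL : SmoothOpOn U L) (hN : SmoothOpOn U N) :
    SmoothOpOn U (fun x => L x + N x) := by
  intro φ hφ i j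
  simp only [LinearMap.add_apply, map_add]
  exact (hL φ hφ i j).add (hN φ hφ i j)

theorem smoothOpOn_const_smul {U : Set M} (c : ℝ) {L : OpField n M} (hL : SmoothOpOn U L) :
    SmoothOpOn U (fun x => c • L x) := by
  intro φ hφ i j
  simp only [LinearMap.smul_apply, map_smul]
  exact (hL φ hφ i j).const_smul c

theorem smoothOpOn_zero (U : Set M) : SmoothOpOn U (fun _ => 0 : OpField n M) := by
  intro φ hφ i j
  simp only [LinearMap.zero_apply, map_zero]
  exact contDiffOn_const

variable [IsManifold (𝓡 n) ∞ M]

theorem mvfderiv_opBracket (L N : OpField n M) (ξ η : ∀ x : M, TangentSpace (𝓡 n) x) (x : M) :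
    mvfderiv (𝓡 n) (chartAt (Coords n) x) x (opBracket L N ξ η x) =
      flatBracket (opHat (chartAt (Coords n) x) L) (opHat (chartAt (Coords n) x) N)
        (vecHat (chartAt (Coords n) x) ξ) (vecHat (chartAt (Coords n) x) η)
        (chartAt (Coords n) x x) := by
  have hφ := IsManifold.chart_mem_maximalAtlas (I := 𝓡 n) (n := ∞) x
  have h1 := opHat_mvfderiv hφ (mem_chart_source _ x)
  have h2 := fun ξ η : ∀ x : M, TangentSpace (𝓡 n) x => toCoords_mlieBracket ξ η x
  rw [opBracket, map_sub, map_sub, map_add, ← h1 L, ← h1 N, ← h1 L, ← h1 N, h2, h2, h2, h2,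
    flatBracket]
  have hL := eventually_vecHat_apply L ξ x
  have hN := eventually_vecHat_apply N η x
  rw [hL.lieBracket_vectorField_eq hN, hL.lieBracket_vectorField_eq (Filter.EventuallyEq.refl _ _),
    Filter.EventuallyEq.lieBracket_vectorField_eq (Filter.EventuallyEq.refl _ _) hN]

theorem BracketVanishesOn.congr {U : Set M} (hU : IsOpen U) {L L' N N' : OpField n M}
    (h : BracketVanishesOn U L N) (hL : ∀ x ∈ U, L' x = L x) (hN : ∀ x ∈ U, N' x = N x) :
    BracketVanishesOn U L' N' := by
  intro ξ η hξ hη x hx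
  rw [opBracket_congr (L' := L) (N' := N)]
  · exact h ξ η hξ hη x hx
  · filter_upwards [hU.mem_nhds hx] with z hz using hL z hz
  · filter_upwards [hU.mem_nhds hx] with z hz using hN z hz

theorem BracketVanishesOn.of_local {U : Set M} {L N : OpField n M}
    (h : ∀ x ∈ U, ∃ V ⊆ U, x ∈ V ∧ BracketVanishesOn V L N) : BracketVanishesOn U L N := by
  intro ξ η hξ hη x hx
  obtain ⟨V, hVU, hxV, hV⟩ := h x hx
  exact hV ξ η (hξ.mono hVU) (hη.mono hVU) x hxV

/-- For commuting operators, `⟨N, L⟩(ξ, η) = -⟨L, N⟩(η, ξ)`. -/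
theorem BracketVanishesOn.swap {U : Set M} {L N : OpField n M} (h : BracketVanishesOn U L N)
    (hLN : ∀ x ∈ U, L x * N x = N x * L x) : BracketVanishesOn U N L := by
  intro ξ η hξ hη x hx
  have h1 := h η ξ hη hξ x hx
  have h2 : L x (N x (mlieBracket (𝓡 n) η ξ x)) = N x (L x (mlieBracket (𝓡 n) η ξ x)) :=
    congrArg (fun A : Module.End ℝ _ => A (mlieBracket (𝓡 n) η ξ x)) (hLN x hx)
  rw [opBracket, h2] at h1
  rw [opBracket, mlieBracket_swap_apply (V := ξ), mlieBracket_swap_apply (W := fun z => L z (η z)),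
    mlieBracket_swap_apply (V := ξ), mlieBracket_swap_apply (W := η), ← neg_eq_zero, ← h1]
  simp only [map_neg]
  abel

/-- The Leibniz identity `⟨LN, R⟩(ξ, η) = ⟨L, R⟩(Nξ, η) + L⟨N, R⟩(ξ, η)`, which needs no
commutation. -/
theorem BracketVanishesOn.mul_left {U : Set M} (hU : IsOpen U) {L N R : OpField n M}
    (hN : SmoothOpOn U N) (hLR : BracketVanishesOn U L R) (hNR : BracketVanishesOn U N R) :
    BracketVanishesOn U (fun x => L x * N x) R := by
  intro ξ η hξ hη x hx
  have h1 := hLR _ η (hN.smoothVecOn hU hξ) hη x hx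
  have h2 := congrArg (L x) (hNR ξ η hξ hη x hx)
  rw [opBracket] at h1 h2
  simp only [map_sub, map_add, map_zero] at h2
  rw [opBracket]
  simp only [Module.End.mul_apply]
  rw [← add_zero (0 : TangentSpace (𝓡 n) x)]
  nth_rewrite 1 [← h1]
  rw [← h2]
  abel

theorem BracketVanishesOn.add_left {U : Set M} (hU : IsOpen U) {L N R : OpField n M}
    (hL : SmoothOpOn U L) (hN : SmoothOpOn U N) (hLR : BracketVanishesOn U L R)
    (hNR : BracketVanishesOn U N R) : BracketVanishesOn U (fun x => L x + N x) R := by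
  have : IsManifold (𝓡 n) 2 M := IsManifold.of_le (n := ∞) ENat.LEInfty.out
  intro ξ η hξ hη x hx
  have hd : ∀ ζ : ∀ x : M, TangentSpace (𝓡 n) x, SmoothVecOn U ζ →
      MDifferentiableAt (𝓡 n) (𝓡 n).tangent
        (fun x => (⟨x, ζ x⟩ : TangentBundle (𝓡 n) M)) x := fun ζ hζ =>
    (ContMDiffOn.contMDiffAt hζ (hU.mem_nhds hx)).mdifferentiableAt (by simp)
  have h3 : ∀ W : ∀ x : M, TangentSpace (𝓡 n) x,
      mlieBracket (𝓡 n) (fun z => (L z + N z) (ξ z)) W x =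
      mlieBracket (𝓡 n) (fun z => L z (ξ z)) W x + mlieBracket (𝓡 n) (fun z => N z (ξ z)) W x :=
    fun W => mlieBracket_add_left (hd _ (hL.smoothVecOn hU hξ)) (hd _ (hN.smoothVecOn hU hξ))
  have h1 := hLR ξ η hξ hη x hx
  have h2 := hNR ξ η hξ hη x hx
  rw [opBracket] at h1 h2 ⊢
  rw [h3, h3]
  simp only [LinearMap.add_apply, map_add]
  rw [← add_zero (0 : TangentSpace (𝓡 n) x)]
  nth_rewrite 1 [← h1]
  rw [← h2]
  abel

theorem BracketVanishesOn.smul_left {U : Set M} (hU : IsOpen U) {L R : OpField n M} (c : ℝ)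
    (hL : SmoothOpOn U L) (hLR : BracketVanishesOn U L R) :
    BracketVanishesOn U (fun x => c • L x) R := by
  have : IsManifold (𝓡 n) 2 M := IsManifold.of_le (n := ∞) ENat.LEInfty.out
  intro ξ η hξ hη x hx
  have hd : MDifferentiableAt (𝓡 n) (𝓡 n).tangent
        (fun x => (⟨x, L x (ξ x)⟩ : TangentBundle (𝓡 n) M)) x :=
    (ContMDiffOn.contMDiffAt (hL.smoothVecOn hU hξ) (hU.mem_nhds hx)).mdifferentiableAt (by simp)
  have h3 : ∀ W : ∀ x : M, TangentSpace (𝓡 n) x,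
      mlieBracket (𝓡 n) (fun z => (c • L z) (ξ z)) W x =
      c • mlieBracket (𝓡 n) (fun z => L z (ξ z)) W x :=
    fun W => mlieBracket_const_smul_left hd
  have h1 := hLR ξ η hξ hη x hx
  rw [opBracket] at h1 ⊢
  rw [h3, h3]
  simp only [LinearMap.smul_apply, map_smul]
  rw [← smul_zero c, ← h1]
  simp only [smul_add, smul_sub]

theorem BracketVanishesOn.zero_left (U : Set M) (R : OpField n M) :
    BracketVanishesOn U (fun _ => 0) R := by
  intro ξ η hξ hη x hx
  have h : ∀ W, mlieBracket (𝓡 n) (fun z => (0 : Module.End ℝ (TangentSpace (𝓡 n) z)) (ξ z)) W x =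
      0 := fun W => congrFun (mlieBracket_zero_left (W := W)) x
  rw [opBracket, h, h]
  simp

theorem BracketVanishesOn.sum_left {ι : Type*} (s : Finset ι) {U : Set M} (hU : IsOpen U)
    {L : ι → OpField n M} {R : OpField n M} (c : ι → ℝ) (hL : ∀ i, SmoothOpOn U (L i))
    (hLR : ∀ i, BracketVanishesOn U (L i) R) :
    SmoothOpOn U (fun x => ∑ i ∈ s, c i • L i x) ∧
      BracketVanishesOn U (fun x => ∑ i ∈ s, c i • L i x) R := by
  classical
  induction s using Finset.induction_on with
  | empty => exact ⟨smoothOpOn_zero U, BracketVanishesOn.zero_left U R⟩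
  | insert a s ha ih =>
    simp only [Finset.sum_insert ha]
    exact ⟨smoothOpOn_add (smoothOpOn_const_smul _ (hL a)) ih.1,
      BracketVanishesOn.add_left hU (smoothOpOn_const_smul _ (hL a)) ih.1
        (BracketVanishesOn.smul_left hU _ (hL a) (hLR a)) ih.2⟩

theorem BracketVanishesOn.one_left (U : Set M) (R : OpField n M) :
    BracketVanishesOn U (fun _ => 1) R := by
  intro ξ η hξ hη x hx
  rw [opBracket]
  simp only [Module.End.one_apply]
  abel

/-- If `P` is a strong symmetry of `R`, then so is its inverse. -/
theorem BracketVanishesOn.inverse_left {U : Set M} (hU : IsOpen U) {P Q R : OpField n M}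
    (hQ : SmoothOpOn U Q) (hPQ : ∀ x ∈ U, P x * Q x = 1) (hQP : ∀ x ∈ U, Q x * P x = 1)
    (hPR : BracketVanishesOn U P R) : BracketVanishesOn U Q R := by
  intro ξ η hξ hη x hx
  have h1 := hPR _ η (hQ.smoothVecOn hU hξ) hη x hx
  have h2 := BracketVanishesOn.one_left U R ξ η hξ hη x hx
  rw [opBracket_congr (L' := fun x => P x * Q x) (N' := R)
    -- `PQ = 1` holds only on `U`, which suffices because the bracket depends on germs.
    (by filter_upwards [hU.mem_nhds hx] with z hz using (hPQ z hz).symm)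
    (Filter.Eventually.of_forall fun _ => rfl)] at h2
  -- The Leibniz identity for `PQ = 1`; as `⟨1, R⟩ = 0`, it isolates `P⟨Q, R⟩`.
  have h3 : P x (opBracket Q R ξ η x) + opBracket P R (fun z => Q z (ξ z)) η x =
      opBracket (fun x => P x * Q x) R ξ η x := by
    simp only [opBracket, map_sub, map_add, Module.End.mul_apply]
    abel
  rw [h1, h2, add_zero] at h3
  have h4 : Q x (P x (opBracket Q R ξ η x)) = opBracket Q R ξ η x :=
    congrArg (fun A : Module.End ℝ _ => A (opBracket Q R ξ η x)) (hQP x hx)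
  rw [← h4, h3, map_zero]

end Brackets

/-! ### Smoothness of determinants and inverse matrices -/

section MatrixSmoothness

variable {E : Type*} [NormedAddCommGroup E] [NormedSpace ℝ E] {ι : Type*} [Fintype ι]
  [DecidableEq ι]

theorem contDiffAt_det {b : E → Matrix ι ι ℝ} {y : E}
    (hb : ∀ i j, ContDiffAt ℝ ∞ (fun z => b z i j) y) : ContDiffAt ℝ ∞ (fun z => (b z).det) y := by
  simp only [Matrix.det_apply]
  exact ContDiffAt.sum fun σ _ => (contDiffAt_prod fun i _ => hb _ _).const_smul _

theorem contDiffAt_inv_apply {b : E → Matrix ι ι ℝ} {y : E}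
    (hb : ∀ i j, ContDiffAt ℝ ∞ (fun z => b z i j) y) (hy : (b y).det ≠ 0) (i j : ι) :
    ContDiffAt ℝ ∞ (fun z => (b z)⁻¹ i j) y := by
  simp only [Matrix.inv_def, Matrix.smul_apply, smul_eq_mul, Ring.inverse_eq_inv',
    Matrix.adjugate_apply]
  refine ((contDiffAt_det hb).inv hy).mul (contDiffAt_det fun k l => ?_)
  by_cases hk : k = j
  · subst hk
    simp only [Matrix.updateRow_self]
    exact contDiffAt_const
  · simp only [Matrix.updateRow_ne hk]
    exact hb k l

end MatrixSmoothness

/-! ### Smoothness of functions and of algebraic operations on operator fields -/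

section SmoothFunctions

variable {n : ℕ} {M : Type*} [TopologicalSpace M] [ChartedSpace (Coords n) M]

theorem smoothOpOn_sum {U : Set M} {ι : Type*} (s : Finset ι) {L : ι → OpField n M}
    (hL : ∀ i, SmoothOpOn U (L i)) : SmoothOpOn U (fun x => ∑ i ∈ s, L i x) := by
  intro φ hφ i j
  simp only [LinearMap.sum_apply, map_sum]
  exact ContDiffOn.sum fun k _ => hL k φ hφ i j

theorem smoothOpOn_mul {U : Set M} {L N : OpField n M}
    (hL : SmoothOpOn U L) (hN : SmoothOpOn U N) : SmoothOpOn U (fun x => L x * N x) := by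
  rw [smoothOpOn_iff] at hL hN ⊢
  intro φ hφ
  refine ((hL φ hφ).clm_comp (hN φ hφ)).congr fun y hy => ?_
  rw [← opHat_mul hφ hy.1]
  rfl

theorem SmoothOpOn.congr {U : Set M} {L N : OpField n M} (hL : SmoothOpOn U L)
    (hLN : ∀ x ∈ U, N x = L x) : SmoothOpOn U N :=
  fun φ hφ i j => (hL φ hφ i j).congr fun y hy => by rw [hLN _ hy.2]

theorem SmoothFormOn.mono {U V : Set M} {α : OneForm n M} (hα : SmoothFormOn U α) (hVU : V ⊆ U) :
    SmoothFormOn V α :=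
  fun φ hφ j => (hα φ hφ j).mono fun _ hy => ⟨hy.1, hVU hy.2⟩

theorem contMDiffOn_iff_charts {U : Set M} (hU : IsOpen U) {f : M → ℝ}
    [IsManifold (𝓡 n) ∞ M] :
    ContMDiffOn (𝓡 n) 𝓘(ℝ, ℝ) ∞ f U ↔ ∀ φ ∈ IsManifold.maximalAtlas (𝓡 n) ∞ M,
      ContDiffOn ℝ ∞ (fun y => f (φ.symm y)) (φ.target ∩ φ.symm ⁻¹' U) := by
  constructor
  · rintro hf φ hφ y ⟨hy, hyU⟩
    have h1 := (contMDiffAt_iff_comp_symm hφ (φ.map_target hy)).1 (hf.contMDiffAt (hU.mem_nhds hyU))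
    rw [φ.right_inv hy] at h1
    exact h1.contDiffWithinAt
  · intro hf x hx
    have hφ := IsManifold.chart_mem_maximalAtlas (I := 𝓡 n) (n := ∞) x
    refine ((contMDiffAt_iff_comp_symm hφ (mem_chart_source _ x)).2 ?_).contMDiffWithinAt
    refine (hf _ hφ).contDiffAt (((chartAt (Coords n) x).symm.isOpen_inter_preimage hU).mem_nhds
      ⟨mem_chart_target _ x, ?_⟩)
    simpa using hx

variable [IsManifold (𝓡 n) ∞ M]

theorem contMDiffOn_inv_apply {U : Set M} (hU : IsOpen U) {ι : Type*} [Fintype ι] [DecidableEq ι]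
    {b : M → Matrix ι ι ℝ} (hb : ∀ i j, ContMDiffOn (𝓡 n) 𝓘(ℝ, ℝ) ∞ (fun x => b x i j) U)
    (hdet : ∀ x ∈ U, (b x).det ≠ 0) (i j : ι) :
    ContMDiffOn (𝓡 n) 𝓘(ℝ, ℝ) ∞ (fun x => (b x)⁻¹ i j) U := by
  simp only [contMDiffOn_iff_charts hU] at hb ⊢
  rintro φ hφ y hy
  have hW := (φ.symm.isOpen_inter_preimage hU).mem_nhds hy
  exact (contDiffAt_inv_apply (b := fun y => b (φ.symm y))
    (fun i j => (hb i j φ hφ).contDiffAt hW) (hdet _ hy.2) i j).contDiffWithinAt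

theorem SmoothOpOn.fun_smul {U : Set M} (hU : IsOpen U) {f : M → ℝ}
    (hf : ContMDiffOn (𝓡 n) 𝓘(ℝ, ℝ) ∞ f U) {L : OpField n M} (hL : SmoothOpOn U L) :
    SmoothOpOn U (fun x => f x • L x) := by
  rw [contMDiffOn_iff_charts hU] at hf
  intro φ hφ i j
  simp only [LinearMap.smul_apply, map_smul]
  exact (hf φ hφ).smul (hL φ hφ i j)

end SmoothFunctions

/-! ### Regular covectors and smoothness of Killing tensors -/

section KillingTensors

variable {n : ℕ} {M : Type*} [TopologicalSpace M] [ChartedSpace (Coords n) M]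

theorem span_eq_top_of_linearIndependent {x : M} {v : Fin n → TangentSpace (𝓡 n) x}
    (hv : LinearIndependent ℝ v) : Submodule.span ℝ (Set.range v) = ⊤ :=
  LinearIndependent.span_eq_top_of_card_eq_finrank' (K := ℝ) (V := Coords n) hv (by simp)

/-- The components of a covector at `φ.symm y`. -/
def pushCovector (φ : OpenPartialHomeomorph M (Coords n)) (y : Coords n) :
    Cotangent n (φ.symm y) →ₗ[ℝ] Coords n →L[ℝ] ℝ where
  toFun q := LinearMap.toContinuousLinearMap (q ∘ₗ (ofCoords φ y).toLinearMap)
  map_add' _ _ := rfl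
  map_smul' _ _ := rfl

variable {φ : OpenPartialHomeomorph M (Coords n)}

theorem pullCovector_pushCovector (hφ : φ ∈ IsManifold.maximalAtlas (𝓡 n) ∞ M) {y : Coords n}
    (hy : y ∈ φ.target) (q : Cotangent n (φ.symm y)) :
    pullCovector φ y (pushCovector φ y q) = q := by
  ext v
  exact congrArg q (ofCoords_toCoords hφ hy v)

theorem pushCovector_pullCovector (hφ : φ ∈ IsManifold.maximalAtlas (𝓡 n) ∞ M) {y : Coords n}
    (hy : y ∈ φ.target) (p : Coords n →L[ℝ] ℝ) :
    pushCovector φ y (pullCovector φ y p) = p := by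
  ext v
  exact congrArg p (toCoords_ofCoords hφ hy v)

theorem linearIndependent_of_coHat {h : Fin n → CoTensor n M} {y : Coords n}
    {p : Coords n →L[ℝ] ℝ} (hp : LinearIndependent ℝ fun s => coHat φ (h s) y p) :
    LinearIndependent ℝ fun s => h s (φ.symm y) (pullCovector φ y p) :=
  LinearIndependent.of_comp (toCoords φ y).toLinearMap hp

theorem exists_regular_covector_coords {h : Fin n → CoTensor n M}
    (hsmooth : ∀ s, SmoothCoTensor (h s)) (hsymm : ∀ s, SymmCoTensor (h s))
    (hgeneric : GenericallyIndependent fun s => quadFun (h s))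
    (hφ : φ ∈ IsManifold.maximalAtlas (𝓡 n) ∞ M) {y : Coords n} (hy : y ∈ φ.target) :
    ∃ p : Coords n →L[ℝ] ℝ, LinearIndependent ℝ fun s => coHat φ (h s) y p := by
  -- Of genericity only the existence of one regular covector at the point is used.
  obtain ⟨p, hp⟩ := (hgeneric φ hφ y hy).nonempty
  refine ⟨covectorOf p, ?_⟩
  have h1 := Matrix.linearIndependent_rows_iff_isUnit.2
    ((Matrix.isUnit_iff_isUnit_det _).2 (isUnit_iff_ne_zero.2 hp))
  rw [Fintype.linearIndependent_iff] at h1 ⊢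
  intro c hc
  refine h1 c (funext fun j => ?_)
  have h2 := congrArg (fun v : Coords n => v j) hc
  simp only [Finset.sum_apply, Pi.smul_apply, Matrix.of_apply, Matrix.row,
    partialP_quadFun hφ (hsmooth _) (hsymm _) hy, smul_eq_mul, Pi.zero_apply,
    mul_left_comm _ (2 : ℝ)]
  simp at h2
  rw [← Finset.mul_sum, h2, mul_zero]

theorem exists_regular_covector [IsManifold (𝓡 n) ∞ M] {h : Fin n → CoTensor n M}
    (hsmooth : ∀ s, SmoothCoTensor (h s)) (hsymm : ∀ s, SymmCoTensor (h s))
    (hgeneric : GenericallyIndependent fun s => quadFun (h s)) (x : M) :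
    ∃ q : Cotangent n x, LinearIndependent ℝ fun s => h s x q := by
  have hφ := IsManifold.chart_mem_maximalAtlas (I := 𝓡 n) (n := ∞) x
  obtain ⟨p, hp⟩ := exists_regular_covector_coords hsmooth hsymm hgeneric hφ (mem_chart_target _ x)
  have h1 : ∃ q : Cotangent n ((chartAt (Coords n) x).symm (chartAt (Coords n) x x)),
    LinearIndependent ℝ fun s => h s _ q := ⟨_, linearIndependent_of_coHat hp⟩
  rwa [(chartAt (Coords n) x).left_inv (mem_chart_source _ x)] at h1

variable [NeZero n]

theorem killingData {h : Fin n → CoTensor n M} (hsymm : ∀ s, SymmCoTensor (h s))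
    (hnd : FirstNondegenerate h)
    (hcomm : ∀ s t x, killing h hnd s x * killing h hnd t x =
      killing h hnd t x * killing h hnd s x) (x : M) :
    KillingData (fun s => h s x) (lower h hnd x) where
  symm s p q := hsymm s x p q
  left_inv p := (LinearEquiv.ofBijective (h 0 x) (hnd x)).symm_apply_apply p
  right_inv v := (LinearEquiv.ofBijective (h 0 x) (hnd x)).apply_symm_apply v
  comm s t v := congrArg (fun A : Module.End ℝ _ => A v) (hcomm s t x)

theorem opHat_killing {h : Fin n → CoTensor n M} (hnd : FirstNondegenerate h)
    (hφ : φ ∈ IsManifold.maximalAtlas (𝓡 n) ∞ M) {y : Coords n} (hy : y ∈ φ.target) (s : Fin n) :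
    (coHat φ (h 0) y).IsInvertible ∧
      opHat φ (killing h hnd s) y = coHat φ (h s) y ∘L (coHat φ (h 0) y).inverse := by
  -- The coordinate expression of `h_1⁻¹`. As the inverse of a smooth family of invertible maps it
  -- depends smoothly on the point.
  let A : Coords n →L[ℝ] Coords n →L[ℝ] ℝ := LinearMap.toContinuousLinearMap
    (pushCovector φ y ∘ₗ lower h hnd (φ.symm y) ∘ₗ (ofCoords φ y).toLinearMap)
  have hA : ∀ v, A v = pushCovector φ y (lower h hnd (φ.symm y) (ofCoords φ y v)) := fun _ => rfl
  have h1 : coHat φ (h 0) y ∘L A = ContinuousLinearMap.id ℝ _ := by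
    ext1 v
    change coHat φ (h 0) y (A v) = v
    rw [hA, coHat_apply, pullCovector_pushCovector hφ hy]
    refine Eq.trans ?_ (toCoords_ofCoords hφ hy v)
    congr 1
    exact (LinearEquiv.ofBijective (h 0 (φ.symm y)) (hnd _)).apply_symm_apply _
  have h2 : A ∘L coHat φ (h 0) y = ContinuousLinearMap.id ℝ _ := by
    ext1 p
    change A (coHat φ (h 0) y p) = p
    rw [hA, coHat_apply, ofCoords_toCoords hφ hy]
    refine Eq.trans ?_ (pushCovector_pullCovector hφ hy p)
    congr 1
    exact (LinearEquiv.ofBijective (h 0 (φ.symm y)) (hnd _)).symm_apply_apply _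
  refine ⟨ContinuousLinearMap.IsInvertible.of_inverse h1 h2, ?_⟩
  rw [ContinuousLinearMap.inverse_eq h1 h2]
  ext1 v
  change _ = coHat φ (h s) y (A v)
  rw [hA, coHat_apply, pullCovector_pushCovector hφ hy]
  rfl

theorem smoothOpOn_killing {h : Fin n → CoTensor n M} (hsmooth : ∀ s, SmoothCoTensor (h s))
    (hnd : FirstNondegenerate h) (U : Set M) (s : Fin n) : SmoothOpOn U (killing h hnd s) := by
  rw [smoothOpOn_iff]
  intro φ hφ
  have h1 : ContDiffOn ℝ ∞ (fun y => coHat φ (h s) y ∘L (coHat φ (h 0) y).inverse) φ.target := by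
    refine ((hsmooth s).contDiffOn hφ).clm_comp fun y hy => ?_
    have h2 := ((hsmooth 0).contDiffOn hφ).contDiffAt (φ.open_target.mem_nhds hy)
    exact ((opHat_killing hnd hφ hy s).1.contDiffAt_map_inverse.comp y h2).contDiffWithinAt
  exact (h1.congr fun y hy => (opHat_killing hnd hφ hy s).2).mono Set.inter_subset_left

theorem smoothOpOn_dualOps [IsManifold (𝓡 n) ∞ M] {h : Fin n → CoTensor n M}
    (hsmooth : ∀ s, SmoothCoTensor (h s)) (hnd : FirstNondegenerate h) {U : Set M} (hU : IsOpen U)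
    {b : M → Matrix (Fin n) (Fin n) ℝ}
    (hb : ∀ i j, ContMDiffOn (𝓡 n) 𝓘(ℝ, ℝ) ∞ (fun x => b x i j) U)
    (hdet : ∀ x ∈ U, (b x).det ≠ 0) (i : Fin n) : SmoothOpOn U (dualOps (killing h hnd) b i) :=
  smoothOpOn_sum _ fun s => SmoothOpOn.fun_smul hU (contMDiffOn_inv_apply hU hb hdet i s)
    (smoothOpOn_killing hsmooth hnd U s)

end KillingTensors

/-! ### Strong symmetries along a regular level -/

section LevelBrackets

variable {n : ℕ} {M : Type*} [TopologicalSpace M] [ChartedSpace (Coords n) M]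

theorem IsRegularLevel.linearIndependent {h : Fin n → CoTensor n M} {U : Set M} {α : OneForm n M}
    (hα : IsRegularLevel h U α) {x : M} (hx : x ∈ U) :
    LinearIndependent ℝ fun s => h s x (α x) := by
  have h1 := hα.regular x hx
  have h2 : (fun s => h s x (α x)) = (LinearMap.lsmul ℝ _ (1 / 2 : ℝ)) ∘
      fun s => velocity h α s x := by
    funext s
    simp [velocity, smul_smul]
  rw [h2]
  refine h1.map' _ (LinearMap.ker_eq_bot_of_injective fun v w hvw => ?_)
  simpa using hvw

theorem IsRegularLevel.localLevel {h : Fin n → CoTensor n M} (hsmooth : ∀ s, SmoothCoTensor (h s))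
    (hsymm : ∀ s, SymmCoTensor (h s))
    (hpoisson : ∀ s t, PoissonCommute (quadFun (h s)) (quadFun (h t))) {U : Set M} (hU : IsOpen U)
    {α : OneForm n M} (hα : IsRegularLevel h U α) {φ : OpenPartialHomeomorph M (Coords n)}
    (hφ : φ ∈ IsManifold.maximalAtlas (𝓡 n) ∞ M) :
    LocalLevel (fun s => coHat φ (h s)) (formHat φ α) (φ.target ∩ φ.symm ⁻¹' U) where
  isOpen := φ.symm.isOpen_inter_preimage hU
  diff s := (((hsmooth s).contDiffOn hφ).differentiableOn (by simp)).mono Set.inter_subset_left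
  symm s y _ p q := coHat_symm (hsymm s) y p q
  poisson s t y hy :=
    (hpoisson s t).poissonAt hφ (hsmooth s) (hsmooth t) (hsymm s) (hsymm t) hy.1
  diff_form := ((smoothFormOn_iff.1 hα.smooth) φ hφ).differentiableOn (by simp)
  level s := by
    obtain ⟨c, hc⟩ := hα.level s
    refine ⟨c, fun y hy => ?_⟩
    rw [coHat_formHat hφ hy.1, formHat_toCoords hφ hy.1]
    exact hc _ hy.2
  span y hy := by
    have h1 := span_eq_top_of_linearIndependent (hα.linearIndependent hy.2)
    have h2 : (Set.range fun s => coHat φ (h s) y (formHat φ α y)) =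
        (toCoords φ y).toLinearMap '' Set.range fun s => h s (φ.symm y) (α (φ.symm y)) := by
      rw [← Set.range_comp]
      congr 1
      funext s
      exact coHat_formHat hφ hy.1 (h s) α
    rw [h2, Submodule.span_image, h1, Submodule.map_top]
    exact LinearMap.range_eq_top.2 (toCoords_surjective hφ hy.1)

variable [IsManifold (𝓡 n) ∞ M]

/-- Commuting self-adjoint operator fields that deform a regular common level are strong symmetries
of each other. -/
theorem IsRegularLevel.bracketVanishesOn {h : Fin n → CoTensor n M}
    (hsmooth : ∀ s, SmoothCoTensor (h s)) (hsymm : ∀ s, SymmCoTensor (h s))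
    (hpoisson : ∀ s t, PoissonCommute (quadFun (h s)) (quadFun (h t))) {U : Set M} (hU : IsOpen U)
    {α : OneForm n M} (hα : IsRegularLevel h U α) {B : Fin n → OpField n M}
    (hB : ∀ i, SmoothOpOn U (B i)) (hcomm : ∀ i j, ∀ x ∈ U, B i x * B j x = B j x * B i x)
    (hadj : ∀ i s, ∀ x ∈ U, ∀ q, B i x (h s x q) = h s x (q ∘ₗ B i x))
    (hconst : ∀ i s, ∃ c : ℝ, ∀ x ∈ U, α x (B i x (h s x (α x))) = c)
    (hsep : ∀ x ∈ U, ∀ v, (∀ i, α x (B i x v) = 0) → v = 0) (i j : Fin n) :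
    BracketVanishesOn U (B i) (B j) := by
  intro ξ η hξ hη x hx
  set φ := chartAt (Coords n) x with hφ_def
  have hφ : φ ∈ IsManifold.maximalAtlas (𝓡 n) ∞ M := IsManifold.chart_mem_maximalAtlas x
  have hH := hα.localLevel hsmooth hsymm hpoisson hU hφ
  have hy : φ x ∈ φ.target ∩ φ.symm ⁻¹' U :=
    ⟨mem_chart_target _ x, by simpa [hφ_def] using hx⟩
  have hdef : ∀ i, LevelDeformation (fun s => coHat φ (h s)) (formHat φ α)
      (φ.target ∩ φ.symm ⁻¹' U) (opHat φ (B i)) := by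
    intro i
    refine ⟨((smoothOpOn_iff.1 (hB i)) φ hφ).differentiableOn (by simp), fun s y hy p => ?_,
      fun s => ?_⟩
    · rw [coHat_apply, opHat_toCoords hφ hy.1, hadj i s _ hy.2, coHat_apply]
      congr 2
      ext v
      simp only [LinearMap.comp_apply, pullCovector_apply, ContinuousLinearMap.comp_apply]
      rw [opHat_toCoords hφ hy.1]
    · obtain ⟨c, hc⟩ := hconst i s
      refine ⟨c, fun y hy => ?_⟩
      rw [coHat_formHat hφ hy.1, opHat_toCoords hφ hy.1, formHat_toCoords hφ hy.1]
      exact hc _ hy.2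
  apply mvfderiv_injective hφ (mem_chart_source _ x)
  rw [map_zero, mvfderiv_opBracket]
  refine hH.flatBracket_eq_zero hdef (fun i j y hy => ?_) hy (fun v hv => ?_)
    (((smoothVecOn_iff hU).1 hξ x hx).differentiableAt (by simp))
    (((smoothVecOn_iff hU).1 hη x hx).differentiableAt (by simp)) i j
  · rw [opHat_mul hφ hy.1, opHat_mul hφ hy.1]
    ext1 v
    rw [opHat_apply, opHat_apply, hcomm i j _ hy.2]
  · obtain ⟨w, rfl⟩ := toCoords_surjective hφ hy.1 v
    rw [hsep _ hy.2 w fun i => ?_, map_zero]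
    have h1 := hv i
    rwa [opHat_toCoords hφ hy.1, formHat_toCoords hφ hy.1] at h1

end LevelBrackets

/-! ### Smooth coefficients with respect to the Killing tensors -/

section Coefficients

variable {n : ℕ} [NeZero n] {M : Type*} [TopologicalSpace M] [ChartedSpace (Coords n) M]
  [IsManifold (𝓡 n) ∞ M]

/-- The coefficients of a smooth combination of the Killing tensors are smooth. -/
theorem contMDiffOn_coefficients {h : Fin n → CoTensor n M} (hsmooth : ∀ s, SmoothCoTensor (h s))
    (hsymm : ∀ s, SymmCoTensor (h s)) (hgeneric : GenericallyIndependent fun s => quadFun (h s))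
    (hnd : FirstNondegenerate h) {U : Set M} (hU : IsOpen U) {N : OpField n M}
    (hN : SmoothOpOn U N) {f : Fin n → M → ℝ}
    (hf : ∀ x ∈ U, N x = ∑ s, f s x • killing h hnd s x) (s : Fin n) :
    ContMDiffOn (𝓡 n) 𝓘(ℝ, ℝ) ∞ (f s) U := by
  intro x hx
  set φ := chartAt (Coords n) x with hφ_def
  have hφ : φ ∈ IsManifold.maximalAtlas (𝓡 n) ∞ M := IsManifold.chart_mem_maximalAtlas x
  have hxs : x ∈ φ.source := mem_chart_source _ x
  have hy : φ x ∈ φ.target ∩ φ.symm ⁻¹' U :=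
    ⟨mem_chart_target _ x, by simpa [hφ_def] using hx⟩
  have hW := φ.symm.isOpen_inter_preimage hU
  refine ((contMDiffAt_iff_comp_symm hφ hxs).2 ?_).contMDiffWithinAt
  -- A covector regular at the centre gives the constant coordinate vector `v`. The vectors `K_s v`
  -- form a basis there, hence nearby, and Cramer's rule recovers the coefficients from `N v`.
  obtain ⟨p, hp⟩ := exists_regular_covector_coords hsmooth hsymm hgeneric hφ hy.1
  let v : Coords n := coHat φ (h 0) (φ x) p
  let A : Coords n → Matrix (Fin n) (Fin n) ℝ :=
    fun y => Matrix.of fun s i => opHat φ (killing h hnd s) y v i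
  have hK : ∀ s, ContDiffAt ℝ ∞ (opHat φ (killing h hnd s)) (φ x) := fun s =>
    ((smoothOpOn_iff.1 (smoothOpOn_killing hsmooth hnd U s)) φ hφ).contDiffAt (hW.mem_nhds hy)
  have hNs : ContDiffAt ℝ ∞ (opHat φ N) (φ x) :=
    ((smoothOpOn_iff.1 hN) φ hφ).contDiffAt (hW.mem_nhds hy)
  have hcomp : ∀ (L : OpField n M), ContDiffAt ℝ ∞ (opHat φ L) (φ x) → ∀ i,
      ContDiffAt ℝ ∞ (fun y => opHat φ L y v i) (φ x) := fun L hL i =>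
    contDiffAt_euclidean.1 (hL.clm_apply contDiffAt_const) i
  have hA : ∀ s i, ContDiffAt ℝ ∞ (fun y => A y s i) (φ x) := fun s i => hcomp _ (hK s) i
  have hv : ∀ s, opHat φ (killing h hnd s) (φ x) v = coHat φ (h s) (φ x) p := by
    intro s
    change opHat φ (killing h hnd s) (φ x) (coHat φ (h 0) (φ x) p) = _
    rw [coHat_apply, opHat_toCoords hφ hy.1, coHat_apply]
    congr 1
    exact congrArg (h s _) ((LinearEquiv.ofBijective (h 0 _) (hnd _)).symm_apply_apply _)
  have hdet : (A (φ x)).det ≠ 0 := by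
    intro h0
    obtain ⟨c, hc, hcA⟩ := Matrix.exists_vecMul_eq_zero_iff.2 h0
    refine hc (funext ((Fintype.linearIndependent_iff.1 hp) c ?_))
    ext i
    have h1 := congrFun hcA i
    simp only [Matrix.vecMul, dotProduct, A, Matrix.of_apply, hv, Pi.zero_apply] at h1
    simpa using h1
  have hev : ∀ᶠ y in nhds (φ x), f s (φ.symm y) =
      ∑ i, opHat φ N y v i * (A y)⁻¹ i s := by
    have h1 := (contDiffAt_det hA).continuousAt.eventually_ne hdet
    filter_upwards [h1, hW.mem_nhds hy] with y hy1 hyW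
    have h2 : (fun i => opHat φ N y v i) = Matrix.vecMul (fun s => f s (φ.symm y)) (A y) := by
      funext i
      rw [opHat_apply, hf _ hyW.2]
      simp [Matrix.vecMul, dotProduct, A, opHat_apply]
    have h3 := congrFun (congrArg (fun w => Matrix.vecMul w (A y)⁻¹) h2) s
    simp only [Matrix.vecMul_vecMul, Matrix.mul_nonsing_inv _ hy1.isUnit, Matrix.vecMul_one] at h3
    exact h3.symm
  refine ContDiffAt.congr_of_eventuallyEq ?_ hev
  exact ContDiffAt.sum fun i _ => (hcomp N hNs i).mul (contDiffAt_inv_apply hA hdet i s)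

end Coefficients

/-! ### Local existence of regular levels -/

section LevelExistence

variable {n : ℕ}

/-- The map `(y, p) ↦ (y, F_1(y, p), …, F_n(y, p))`. -/
def momentMap (k : Fin n → Coords n → (Coords n →L[ℝ] ℝ) →L[ℝ] Coords n)
    (z : Coords n × (Coords n →L[ℝ] ℝ)) : Coords n × (Fin n → ℝ) :=
  (z.1, fun s => z.2 (k s z.1 z.2))

/-- On vertical vectors `(0, q)` the derivative is `q ↦ 2 q(k_s p)`, injective because the `k_s p`
span. The first component is the identity in `u`, and the dimensions agree. -/
theorem exists_hasFDerivAt_momentMap {k : Fin n → Coords n → (Coords n →L[ℝ] ℝ) →L[ℝ] Coords n}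
    {y : Coords n} (hk : ∀ s, DifferentiableAt ℝ (k s) y)
    (hsymm : ∀ s (p q : Coords n →L[ℝ] ℝ), p (k s y q) = q (k s y p)) {p : Coords n →L[ℝ] ℝ}
    (hp : LinearIndependent ℝ fun s => k s y p) :
    ∃ e : (Coords n × (Coords n →L[ℝ] ℝ)) ≃L[ℝ] Coords n × (Fin n → ℝ),
      HasFDerivAt (momentMap k)
        (e : (Coords n × (Coords n →L[ℝ] ℝ)) →L[ℝ] Coords n × (Fin n → ℝ)) (y, p) := by
  have h1 : ∀ s, ∃ D : (Coords n × (Coords n →L[ℝ] ℝ)) →L[ℝ] ℝ,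
      HasFDerivAt (fun z : Coords n × (Coords n →L[ℝ] ℝ) => z.2 (k s z.1 z.2)) D (y, p) ∧
      ∀ u q, D (u, q) = q (k s y p) + (p (fderiv ℝ (k s) y u p) + p (k s y q)) := fun s =>
    hasFDerivAt_quadratic (ContinuousLinearMap.id ℝ (Coords n →L[ℝ] ℝ)) (hk s) p
  choose D hD hDa using h1
  have hfst : HasFDerivAt (Prod.fst : Coords n × (Coords n →L[ℝ] ℝ) → Coords n)
      (ContinuousLinearMap.fst ℝ _ _) (y, p) := hasFDerivAt_fst
  have h2 : HasFDerivAt (momentMap k)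
      ((ContinuousLinearMap.fst ℝ _ _).prod (ContinuousLinearMap.pi D)) (y, p) :=
    hfst.prodMk (hasFDerivAt_pi.2 hD)
  have hspan : Submodule.span ℝ (Set.range fun s => k s y p) = ⊤ :=
    hp.span_eq_top_of_card_eq_finrank' (by simp)
  have hinj : Function.Injective
      ((ContinuousLinearMap.fst ℝ (Coords n) (Coords n →L[ℝ] ℝ)).prod
        (ContinuousLinearMap.pi D)).toLinearMap := by
    rw [injective_iff_map_eq_zero]
    rintro ⟨u, q⟩ huq
    have hu : u = 0 := congrArg Prod.fst huq
    subst hu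
    have hq : ∀ s, q (k s y p) = 0 := by
      intro s
      have h3 : D s (0, q) = 0 := congrFun (congrArg Prod.snd huq) s
      rw [hDa, hsymm s p q] at h3
      simp only [map_zero, zero_apply] at h3
      linarith
    have h4 : q.toLinearMap = 0 := LinearMap.ext_on_range hspan fun s => by simpa using hq s
    have h5 : q = 0 := ContinuousLinearMap.coe_injective h4
    rw [h5]
    rfl
  have hdim : Module.finrank ℝ (Coords n × (Coords n →L[ℝ] ℝ)) =
      Module.finrank ℝ (Coords n × (Fin n → ℝ)) := by
    have h3 : Module.finrank ℝ (Coords n →L[ℝ] ℝ) = n := by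
      rw [← LinearEquiv.finrank_eq (LinearMap.toContinuousLinearMap
        (𝕜 := ℝ) (E := Coords n) (F' := ℝ))]
      exact (Subspace.dual_finrank_eq (K := ℝ) (V := Coords n)).trans (by simp)
    simp [h3]
  refine ⟨(LinearMap.linearEquivOfInjective _ hinj hdim).toContinuousLinearEquiv, ?_⟩
  convert h2 using 1
  rfl

theorem contDiffAt_momentMap {k : Fin n → Coords n → (Coords n →L[ℝ] ℝ) →L[ℝ] Coords n}
    {z : Coords n × (Coords n →L[ℝ] ℝ)} (hk : ∀ s, ContDiffAt ℝ ∞ (k s) z.1) :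
    ContDiffAt ℝ ∞ (momentMap k) z := by
  refine contDiffAt_fst.prodMk (contDiffAt_pi.2 fun s => ?_)
  exact contDiffAt_snd.clm_apply (((hk s).comp z contDiffAt_fst).clm_apply contDiffAt_snd)

theorem exists_level_coords {k : Fin n → Coords n → (Coords n →L[ℝ] ℝ) →L[ℝ] Coords n}
    {W : Set (Coords n)} (hW : IsOpen W) (hk : ∀ s, ContDiffOn ℝ ∞ (k s) W)
    (hsymm : ∀ s, ∀ y ∈ W, ∀ p q : Coords n →L[ℝ] ℝ, p (k s y q) = q (k s y p)) {y₀ : Coords n}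
    (hy₀ : y₀ ∈ W) {p₀ : Coords n →L[ℝ] ℝ} (hp₀ : LinearIndependent ℝ fun s => k s y₀ p₀) :
    ∃ V ⊆ W, IsOpen V ∧ y₀ ∈ V ∧ ∃ a : Coords n → Coords n →L[ℝ] ℝ, ContDiffOn ℝ ∞ a V ∧
      (∀ s, ∃ c : ℝ, ∀ y ∈ V, a y (k s y (a y)) = c) ∧
      ∀ y ∈ V, LinearIndependent ℝ fun s => k s y (a y) := by
  have hka : ∀ s, ∀ y ∈ W, ContDiffAt ℝ ∞ (k s) y :=
    fun s y hy => (hk s).contDiffAt (hW.mem_nhds hy)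
  have hder : ∀ y ∈ W, ∀ p : Coords n →L[ℝ] ℝ, (LinearIndependent ℝ fun s => k s y p) →
      ∃ e : (Coords n × (Coords n →L[ℝ] ℝ)) ≃L[ℝ] Coords n × (Fin n → ℝ),
      HasFDerivAt (momentMap k)
        (e : (Coords n × (Coords n →L[ℝ] ℝ)) →L[ℝ] Coords n × (Fin n → ℝ)) (y, p) :=
    fun y hy p hp => exists_hasFDerivAt_momentMap
      (fun s => (hka s y hy).differentiableAt (by simp)) (fun s p q => hsymm s y hy p q) hp
  have hli : ∀ v : Fin n → Coords n, (Matrix.of fun s i => v s i).det ≠ 0 ↔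
      LinearIndependent ℝ v := by
    intro v
    rw [← isUnit_iff_ne_zero, ← Matrix.isUnit_iff_isUnit_det,
      ← Matrix.linearIndependent_rows_iff_isUnit]
    exact LinearMap.linearIndependent_iff
      (WithLp.linearEquiv 2 ℝ (Fin n → ℝ)).toLinearMap (LinearEquiv.ker _)
  -- Nonvanishing of `δ` is the open condition of regularity. Imposing it on the local inverse makes
  -- the derivative invertible at every point of `V`, so the inverse is smooth throughout and the
  -- level stays regular.
  let δ : Coords n × (Coords n →L[ℝ] ℝ) → ℝ :=
    fun z => (Matrix.of fun s i => k s z.1 z.2 i).det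
  have hδ : ContinuousOn δ (Prod.fst ⁻¹' W) := by
    intro z hz
    refine (ContDiffAt.continuousAt (𝕜 := ℝ) (n := ∞) (contDiffAt_det fun s i => ?_)).continuousWithinAt
    exact contDiffAt_euclidean.1
      (((hka s z.1 hz).comp z contDiffAt_fst).clm_apply contDiffAt_snd) i
  have hG : IsOpen (Prod.fst ⁻¹' W ∩ δ ⁻¹' {0}ᶜ) :=
    hδ.isOpen_inter_preimage (hW.preimage continuous_fst) isOpen_compl_singleton
  obtain ⟨e₀, he₀⟩ := hder y₀ hy₀ p₀ hp₀
  let e := (contDiffAt_momentMap (z := (y₀, p₀)) fun s => hka s y₀ hy₀).toOpenPartialHomeomorph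
    (momentMap k) he₀ (by simp)
  have he : ∀ z, e z = momentMap k z := fun z => rfl
  have hz₀ : (y₀, p₀) ∈ e.source := ContDiffAt.mem_toOpenPartialHomeomorph_source _ he₀ (by simp)
  -- The level through `(y₀, p₀)`. It is a graph over `V`, traced by the local inverse on the slice
  -- with second component `c`.
  let c : Fin n → ℝ := fun s => p₀ (k s y₀ p₀)
  have hc : e (y₀, p₀) = (y₀, c) := rfl
  let V : Set (Coords n) :=
    (fun y => (y, c)) ⁻¹' (e.target ∩ e.symm ⁻¹' (Prod.fst ⁻¹' W ∩ δ ⁻¹' {0}ᶜ))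
  have hV : ∀ y ∈ V, momentMap k (e.symm (y, c)) = (y, c) := fun y hy => e.right_inv hy.1
  have hV1 : ∀ y ∈ V, (e.symm (y, c)).1 = y := fun y hy => congrArg Prod.fst (hV y hy)
  have hVW : V ⊆ W := fun y hy => by
    rw [← hV1 y hy]
    exact hy.2.1
  refine ⟨V, hVW, ?_, ?_, fun y => (e.symm (y, c)).2, ?_, fun s => ⟨c s, fun y hy => ?_⟩,
    fun y hy => ?_⟩
  · exact (e.symm.isOpen_inter_preimage hG).preimage (by fun_prop)
  · change (y₀, c) ∈ e.target ∧ e.symm (y₀, c) ∈ (Prod.fst ⁻¹' W ∩ δ ⁻¹' {0}ᶜ)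
    rw [← hc, e.left_inv hz₀]
    exact ⟨e.map_source hz₀, hy₀, (hli _).2 hp₀⟩
  · intro y hy
    have hy2 : LinearIndependent ℝ fun s => k s (e.symm (y, c)).1 (e.symm (y, c)).2 :=
      (hli _).1 hy.2.2
    obtain ⟨f, hf⟩ := hder _ hy.2.1 _ hy2
    have h1 : ContDiffAt ℝ ∞ e.symm (y, c) := e.contDiffAt_symm hy.1 hf
      (contDiffAt_momentMap fun s => hka s _ hy.2.1)
    exact (contDiffAt_snd.comp y (h1.comp y (contDiffAt_id.prodMk contDiffAt_const))).contDiffWithinAt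
  · have h1 := congrFun (congrArg Prod.snd (hV y hy)) s
    have h2 : (momentMap k (e.symm (y, c))).2 s =
      (e.symm (y, c)).2 (k s (e.symm (y, c)).1 (e.symm (y, c)).2) := rfl
    rw [h2, hV1 y hy] at h1
    exact h1
  · have hy2 : LinearIndependent ℝ fun s => k s (e.symm (y, c)).1 (e.symm (y, c)).2 :=
      (hli _).1 hy.2.2
    rwa [hV1 y hy] at hy2

variable {M : Type*} [TopologicalSpace M] [ChartedSpace (Coords n) M]

theorem smoothFormOn_pullback {φ : OpenPartialHomeomorph M (Coords n)}
    (hφ : φ ∈ IsManifold.maximalAtlas (𝓡 n) ∞ M) {V : Set (Coords n)} (hV : IsOpen V)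
    {a : Coords n → Coords n →L[ℝ] ℝ} (ha : ContDiffOn ℝ ∞ a V) :
    SmoothFormOn (φ.source ∩ φ ⁻¹' V)
      (fun x => (a (φ x)).toLinearMap ∘ₗ (mvfderiv (𝓡 n) φ x).toLinearMap) := by
  intro ψ hψ j
  set W := ψ.target ∩ ψ.symm ⁻¹' (φ.source ∩ φ ⁻¹' V) with hW_def
  have hW : IsOpen W := ψ.symm.isOpen_inter_preimage (φ.isOpen_inter_preimage hV)
  have hτ : ContDiffOn ℝ ∞ (fun z => φ (ψ.symm z)) W := by
    rw [← contMDiffOn_iff_contDiffOn]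
    exact (contMDiffOn_of_mem_maximalAtlas hφ).comp
      ((contMDiffOn_symm_of_mem_maximalAtlas hψ).mono Set.inter_subset_left) fun z hz => hz.2.1
  -- In another chart the components are those of `a` composed with the transition map and paired
  -- with its derivative.
  have h1 : ContDiffOn ℝ ∞ (fun z => a (φ (ψ.symm z))
      (fderiv ℝ (fun z => φ (ψ.symm z)) z (EuclideanSpace.single j 1))) W :=
    (ha.comp hτ fun z hz => hz.2.2).clm_apply
      ((hτ.fderiv_of_isOpen hW (by simp)).clm_apply contDiffOn_const)
  refine h1.congr fun z hz => ?_
  have h2 : fderiv ℝ (fun z => φ (ψ.symm z)) z =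
      (mfderiv (𝓡 n) (𝓡 n) φ (ψ.symm z)) ∘L (mfderiv (𝓡 n) (𝓡 n) ψ.symm z) := by
    rw [← mfderiv_eq_fderiv]
    exact mfderiv_comp z ((mdifferentiable_of_mem_maximalAtlas hφ).mdifferentiableAt hz.2.1)
      ((mdifferentiable_of_mem_maximalAtlas hψ).mdifferentiableAt_symm hz.1)
  rw [h2]
  rfl

theorem exists_isRegularLevel [IsManifold (𝓡 n) ∞ M] {h : Fin n → CoTensor n M}
    (hsmooth : ∀ s, SmoothCoTensor (h s)) (hsymm : ∀ s, SymmCoTensor (h s))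
    (hgeneric : GenericallyIndependent fun s => quadFun (h s)) (x₀ : M) :
    ∃ U : Set M, IsOpen U ∧ x₀ ∈ U ∧ ∃ α : OneForm n M, IsRegularLevel h U α := by
  set φ := chartAt (Coords n) x₀ with hφ_def
  have hφ : φ ∈ IsManifold.maximalAtlas (𝓡 n) ∞ M := IsManifold.chart_mem_maximalAtlas x₀
  have hx₀ : x₀ ∈ φ.source := mem_chart_source _ x₀
  obtain ⟨p, hp⟩ := exists_regular_covector_coords hsmooth hsymm hgeneric hφ (φ.map_source hx₀)
  obtain ⟨V, hVW, hV, hyV, a, ha, hlevel, hli⟩ := exists_level_coords φ.open_target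
    (fun s => (hsmooth s).contDiffOn hφ) (fun s y _ => coHat_symm (hsymm s) y)
    (φ.map_source hx₀) hp
  refine ⟨φ.source ∩ φ ⁻¹' V, φ.isOpen_inter_preimage hV, ⟨hx₀, hyV⟩, _,
    smoothFormOn_pullback hφ hV ha, fun s => ?_, ?_⟩
  · obtain ⟨c, hc⟩ := hlevel s
    refine ⟨c, ?_⟩
    rintro x ⟨hx, hxV⟩
    rw [← hc _ hxV]
    obtain ⟨y, hy, rfl⟩ : ∃ y ∈ φ.target, φ.symm y = x := ⟨φ x, φ.map_source hx, φ.left_inv hx⟩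
    simp only [φ.right_inv hy]
    rfl
  · rintro x ⟨hx, hxV⟩
    have h1 := hli _ hxV
    obtain ⟨y, hy, rfl⟩ : ∃ y ∈ φ.target, φ.symm y = x := ⟨φ x, φ.map_source hx, φ.left_inv hx⟩
    rw [φ.right_inv hy] at h1
    have h2 := linearIndependent_of_coHat h1
    have h3 := h2.map' (LinearMap.lsmul ℝ _ (2 : ℝ))
      (LinearMap.ker_eq_bot_of_injective fun v w hvw => by simpa using hvw)
    simp only [velocity, φ.right_inv hy]
    exact h3

end LevelExistence

/-! ### Insensitivity to values outside the open set -/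

section

variable {n : ℕ} {M : Type*} [TopologicalSpace M] [ChartedSpace (Coords n) M]
  [IsManifold (𝓡 n) ∞ M]

theorem StrongSymmetryOn.congr {U : Set M} (hU : IsOpen U)
    {L L' N N' : OpField n M} (hLN : StrongSymmetryOn U L N) (hL : ∀ x ∈ U, L' x = L x)
    (hN : ∀ x ∈ U, N' x = N x) : StrongSymmetryOn U L' N' :=
  ⟨fun x hx => by rw [hL x hx, hN x hx, hLN.1 x hx], hLN.2.congr hU hL hN⟩

theorem GeneratesSym.congr {U : Set M} (hU : IsOpen U)
    {B B' : Fin n → OpField n M} (hB : GeneratesSym U B) (h : ∀ i, ∀ x ∈ U, B' i x = B i x) :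
    GeneratesSym U B' where
  smooth i := (hB.smooth i).congr (h i)
  strong i j := (hB.strong i j).congr hU (h i) (h j)
  cyclic x hx := (hB.cyclic x hx).imp fun ξ hξ => by simpa only [h _ x hx] using hξ
  cocyclic x hx := (hB.cocyclic x hx).imp fun q hq => by simpa only [h _ x hx] using hq

theorem Sym.congr {U : Set M} (hU : IsOpen U)
    {B B' : Fin n → OpField n M} (h : ∀ i, ∀ x ∈ U, B' i x = B i x) : Sym U B' = Sym U B :=
  Set.Subset.antisymm
    (fun _ hN => ⟨hN.1, fun i => (hN.2 i).congr hU (fun _ _ => rfl) fun x hx => (h i x hx).symm⟩)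
    (fun _ hN => ⟨hN.1, fun i => (hN.2 i).congr hU (fun _ _ => rfl) fun x hx => h i x hx⟩)

end

/-! ### Dual operators for constant functionals and their symmetry algebra -/

section KillingSystems

variable {n : ℕ} [NeZero n] {M : Type*} [TopologicalSpace M] [ChartedSpace (Coords n) M]

/-- Poisson commuting quadratic functions with commuting Killing tensors, together with the
structure functions of the algebra of Killing tensors. -/
structure KillingSystem (h : Fin n → CoTensor n M) (hnd : FirstNondegenerate h)
    (a : Fin n → Fin n → Fin n → M → ℝ) : Prop where
  smooth : ∀ s, SmoothCoTensor (h s)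
  symm : ∀ s, SymmCoTensor (h s)
  poisson : ∀ s t, PoissonCommute (quadFun (h s)) (quadFun (h t))
  generic : GenericallyIndependent fun s => quadFun (h s)
  comm : ∀ s t x, killing h hnd s x * killing h hnd t x = killing h hnd t x * killing h hnd s x
  smooth_structure : ∀ i j s, ContMDiff (𝓡 n) 𝓘(ℝ, ℝ) ∞ (a i j s)
  mul : ∀ i j x, killing h hnd i x * killing h hnd j x = ∑ s, a i j s x • killing h hnd s x

variable {h : Fin n → CoTensor n M} {hnd : FirstNondegenerate h}

theorem linearIndependent_killing [IsManifold (𝓡 n) ∞ M] (hsmooth : ∀ s, SmoothCoTensor (h s))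
    (hsymm : ∀ s, SymmCoTensor (h s)) (hgeneric : GenericallyIndependent fun s => quadFun (h s))
    (hcomm : ∀ s t x, killing h hnd s x * killing h hnd t x =
      killing h hnd t x * killing h hnd s x) (x : M) :
    LinearIndependent ℝ fun s => killing h hnd s x := by
  obtain ⟨q, hq⟩ := exists_regular_covector hsmooth hsymm hgeneric x
  exact (killingData hsymm hnd hcomm x).linearIndependent hq

theorem exists_coefficients [IsManifold (𝓡 n) ∞ M] (hsmooth : ∀ s, SmoothCoTensor (h s))
    (hsymm : ∀ s, SymmCoTensor (h s)) (hgeneric : GenericallyIndependent fun s => quadFun (h s))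
    (hcomm : ∀ s t x, killing h hnd s x * killing h hnd t x =
      killing h hnd t x * killing h hnd s x) {U : Set M} (hU : IsOpen U) {N : OpField n M}
    (hN : SmoothOpOn U N)
    (hNK : ∀ x ∈ U, ∀ s, N x * killing h hnd s x = killing h hnd s x * N x) :
    ∃ f : Fin n → M → ℝ, (∀ s, ContMDiffOn (𝓡 n) 𝓘(ℝ, ℝ) ∞ (f s) U) ∧
      ∀ x ∈ U, N x = ∑ s, f s x • killing h hnd s x := by
  have h1 : ∀ x, ∃ c : Fin n → ℝ, x ∈ U → N x = ∑ s, c s • killing h hnd s x := by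
    intro x
    by_cases hx : x ∈ U
    · obtain ⟨q, hq⟩ := exists_regular_covector hsmooth hsymm hgeneric x
      obtain ⟨c, hc⟩ := (killingData hsymm hnd hcomm x).mem_span_of_commute
        (span_eq_top_of_linearIndependent hq) (hNK x hx)
      exact ⟨c, fun _ => hc⟩
    · exact ⟨0, fun hx' => absurd hx' hx⟩
  choose c hc using h1
  exact ⟨fun s x => c x s, contMDiffOn_coefficients hsmooth hsymm hgeneric hnd hU hN hc, hc⟩

theorem exists_killingSystem [IsManifold (𝓡 n) ∞ M] (hsmooth : ∀ s, SmoothCoTensor (h s))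
    (hsymm : ∀ s, SymmCoTensor (h s))
    (hpoisson : ∀ s t, PoissonCommute (quadFun (h s)) (quadFun (h t)))
    (hgeneric : GenericallyIndependent fun s => quadFun (h s))
    (hcomm : ∀ s t x, killing h hnd s x * killing h hnd t x =
      killing h hnd t x * killing h hnd s x) : ∃ a, KillingSystem h hnd a := by
  have h1 : ∀ i j, ∃ f : Fin n → M → ℝ,
      (∀ s, ContMDiffOn (𝓡 n) 𝓘(ℝ, ℝ) ∞ (f s) Set.univ) ∧
      ∀ x ∈ Set.univ, killing h hnd i x * killing h hnd j x = ∑ s, f s x • killing h hnd s x := by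
    intro i j
    refine exists_coefficients hsmooth hsymm hgeneric hcomm isOpen_univ
      (smoothOpOn_mul (smoothOpOn_killing hsmooth hnd _ i) (smoothOpOn_killing hsmooth hnd _ j))
      fun x _ s => ?_
    -- A product of Killing tensors commutes with all of them, so it lies in their span with smooth
    -- coefficients: these are the structure functions.
    rw [mul_assoc, hcomm j s x, ← mul_assoc, hcomm i s x, mul_assoc]
  choose a ha hmul using h1
  exact ⟨a, hsmooth, hsymm, hpoisson, hgeneric, hcomm,
    fun i j s => contMDiffOn_univ.1 (ha i j s), fun i j x => hmul i j x trivial⟩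

variable {a : Fin n → Fin n → Fin n → M → ℝ}

/-- The dual operators of the Killing tensors with respect to the form given by constants `c`. -/
abbrev constDualOps (h : Fin n → CoTensor n M) (hnd : FirstNondegenerate h)
    (a : Fin n → Fin n → Fin n → M → ℝ) (c : Fin n → ℝ) : Fin n → OpField n M :=
  dualOps (killing h hnd) (frobeniusMatrix a c)

theorem constDualOps_apply (c : Fin n → ℝ) (i : Fin n) (x : M) :
    constDualOps h hnd a c i x = dualFamily (fun s => killing h hnd s x)
      (structureMatrix (fun i j s => a i j s x) c) i := rfl

theorem killing_zero (x : M) : killing h hnd 0 x = 1 := by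
  ext1 v
  exact (LinearEquiv.ofBijective (h 0 x) (hnd x)).apply_symm_apply v

theorem commute_killing_of_commute {c : Fin n → ℝ} {x : M} (hc : (frobeniusMatrix a c x).det ≠ 0)
    {N : OpField n M} (hN : ∀ i, N x * constDualOps h hnd a c i x =
      constDualOps h hnd a c i x * N x) (s : Fin n) :
    N x * killing h hnd s x = killing h hnd s x * N x :=
  commute_of_commute_dualFamily (K := fun s => killing h hnd s x) hc hN s

theorem commute_constDualOps_of_commute {c : Fin n → ℝ} (d : Fin n → ℝ) {x : M}
    (hc : (frobeniusMatrix a c x).det ≠ 0) {N : OpField n M}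
    (hN : ∀ i, N x * constDualOps h hnd a c i x = constDualOps h hnd a c i x * N x) (i : Fin n) :
    N x * constDualOps h hnd a d i x = constDualOps h hnd a d i x * N x := by
  change Commute (N x) _
  refine Commute.sum_right _ _ _ fun s _ => ?_
  exact (show Commute (N x) _ from commute_killing_of_commute hc hN s).smul_right _

namespace KillingSystem

variable (S : KillingSystem h hnd a)

include S

theorem killingData (x : M) : KillingData (fun s => h s x) (lower h hnd x) :=
  OperatorFrobenius.killingData S.symm hnd S.comm x

theorem commute (c d : Fin n → ℝ) (i j : Fin n) (x : M) :
    constDualOps h hnd a c i x * constDualOps h hnd a d j x =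
      constDualOps h hnd a d j x * constDualOps h hnd a c i x :=
  dualFamily_commute (fun s t => S.comm s t x) _ _ i j

theorem exists_levelMatrix_eq {U : Set M} {α : OneForm n M} (hα : IsRegularLevel h U α) :
    ∃ d : Fin n → ℝ, ∀ x ∈ U, levelMatrix h hnd α x = frobeniusMatrix a d x ∧
      levelMatrix h hnd α x = velocityMatrix (fun s => h s x) (lower h hnd x) (α x) ∧
      (frobeniusMatrix a d x).det ≠ 0 := by
  choose c hc using hα.level
  -- Since `ξ_s = 2 h_s(α)`, the metric contributes a factor 4 to the level values.
  refine ⟨fun s => 4 * c s, fun x hx => ?_⟩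
  have h1 : levelMatrix h hnd α x = velocityMatrix (fun s => h s x) (lower h hnd x) (α x) := rfl
  have h2 : levelMatrix h hnd α x = frobeniusMatrix a (fun s => 4 * c s) x := by
    rw [h1, (S.killingData x).velocityMatrix_eq (a := fun i j s => a i j s x)
      fun i j => S.mul i j x]
    simp only [← hc _ x hx]
    rfl
  refine ⟨h2, h1, ?_⟩
  rw [← h2, h1]
  exact (S.killingData x).det_velocityMatrix_ne_zero (hα.linearIndependent hx)
    (span_eq_top_of_linearIndependent (hα.linearIndependent hx))

variable [IsManifold (𝓡 n) ∞ M]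

theorem linearIndependent (x : M) : LinearIndependent ℝ fun s => killing h hnd s x :=
  linearIndependent_killing S.smooth S.symm S.generic S.comm x

theorem sum_mul {c d : Fin n → ℝ} {x : M} (hc : (frobeniusMatrix a c x).det ≠ 0)
    (hd : (frobeniusMatrix a d x).det ≠ 0) (i : Fin n) :
    (∑ j, c j • constDualOps h hnd a d j x) * constDualOps h hnd a c i x =
      constDualOps h hnd a d i x :=
  sum_smul_dualFamily_mul (S.linearIndependent x) (fun i j => S.mul i j x) hc hd i

theorem sum_mul_sum {c d : Fin n → ℝ} {x : M} (hc : (frobeniusMatrix a c x).det ≠ 0)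
    (hd : (frobeniusMatrix a d x).det ≠ 0) :
    (∑ j, c j • constDualOps h hnd a d j x) * (∑ j, d j • constDualOps h hnd a c j x) = 1 :=
  sum_smul_dualFamily_mul_sum (S.linearIndependent x) (fun i j => S.mul i j x)
    (killing_zero (hnd := hnd) x) hc hd

theorem contMDiff_frobeniusMatrix (c : Fin n → ℝ) (i j : Fin n) :
    ContMDiff (𝓡 n) 𝓘(ℝ, ℝ) ∞ fun x => frobeniusMatrix a c x i j := by
  rw [← contMDiffOn_univ, contMDiffOn_iff_charts isOpen_univ]
  intro φ hφ
  have h1 := fun s => (contMDiffOn_iff_charts isOpen_univ).1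
    ((S.smooth_structure i j s).contMDiffOn (s := Set.univ)) φ hφ
  simp only [frobeniusMatrix, Matrix.of_apply]
  exact ContDiffOn.sum fun s _ => (h1 s).mul contDiffOn_const

theorem smoothOpOn {U : Set M} (hU : IsOpen U) {c : Fin n → ℝ}
    (hc : ∀ x ∈ U, (frobeniusMatrix a c x).det ≠ 0) (i : Fin n) :
    SmoothOpOn U (constDualOps h hnd a c i) :=
  smoothOpOn_dualOps S.smooth hnd hU
    (fun i j => (S.contMDiff_frobeniusMatrix c i j).contMDiffOn) hc i

/-- Here `M_d^i = Q M_c^i`, where `Q = ∑ c_j M_d^j` is the inverse of `∑ d_j M_c^j`. The latter is a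
constant combination of the `M_c^j`, so `R` has zero bracket with it, hence with its inverse and
with the product. -/
theorem strongSymmetryOn_of {U : Set M} (hU : IsOpen U) {c d : Fin n → ℝ}
    (hc : ∀ x ∈ U, (frobeniusMatrix a c x).det ≠ 0)
    (hd : ∀ x ∈ U, (frobeniusMatrix a d x).det ≠ 0) {R : OpField n M}
    (hR : ∀ i, StrongSymmetryOn U R (constDualOps h hnd a c i)) (i : Fin n) :
    StrongSymmetryOn U R (constDualOps h hnd a d i) := by
  have hcomm : ∀ x ∈ U, R x * constDualOps h hnd a d i x = constDualOps h hnd a d i x * R x :=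
    fun x hx => commute_constDualOps_of_commute d (hc x hx) (fun i => (hR i).1 x hx) i
  refine ⟨hcomm, BracketVanishesOn.swap ?_ fun x hx => (hcomm x hx).symm⟩
  have h1 : ∀ i, BracketVanishesOn U (constDualOps h hnd a c i) R :=
    fun i => (hR i).2.swap (hR i).1
  have h2 := BracketVanishesOn.sum_left Finset.univ hU d (S.smoothOpOn hU hc) h1
  have hP : SmoothOpOn U fun x => ∑ j, c j • constDualOps h hnd a d j x :=
    smoothOpOn_sum _ fun j => smoothOpOn_const_smul _ (S.smoothOpOn hU hd j)
  have h3 := BracketVanishesOn.inverse_left hU hP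
    (fun x hx => S.sum_mul_sum (hd x hx) (hc x hx))
    (fun x hx => S.sum_mul_sum (hc x hx) (hd x hx)) h2.2
  exact (BracketVanishesOn.mul_left hU (S.smoothOpOn hU hc i) h3 (h1 i)).congr hU
    (fun x hx => (S.sum_mul (hc x hx) (hd x hx) i).symm) fun _ _ => rfl

theorem bracketVanishesOn_of_level {U : Set M} (hU : IsOpen U) {α : OneForm n M}
    (hα : IsRegularLevel h U α) {d : Fin n → ℝ}
    (hd : ∀ x ∈ U, frobeniusMatrix a d x =
      velocityMatrix (fun s => h s x) (lower h hnd x) (α x))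
    (hdet : ∀ x ∈ U, (frobeniusMatrix a d x).det ≠ 0) (i j : Fin n) :
    BracketVanishesOn U (constDualOps h hnd a d i) (constDualOps h hnd a d j) := by
  refine hα.bracketVanishesOn S.smooth S.symm S.poisson hU (S.smoothOpOn hU hdet)
    (fun i j x _ => S.commute d d i j x)
    (fun i s x _ q => (S.killingData x).adjoint_dualFamily _ i s q) (fun i s => ?_)
    (fun x hx v hv => ?_) i j
  · refine ⟨(1 : Matrix (Fin n) (Fin n) ℝ) i s / 4, fun x hx => ?_⟩
    have h1 := hdet x hx
    rw [hd x hx] at h1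
    rw [← (S.killingData x).apply_dualFamily h1 i s, ← hd x hx]
    rfl
  · refine (S.killingData x).eq_zero_of_apply_eq_zero
      (span_eq_top_of_linearIndependent (hα.linearIndependent hx)) fun s => ?_
    -- The `K_s` are combinations of the dual operators, so a vector killed by all `α ∘ M^i` is
    -- killed by all `α ∘ K_s`.
    have h1 := sum_smul_dualFamily (fun s => killing h hnd s x) (hdet x hx) s
    have h2 := congrArg (fun A : Module.End ℝ _ => α x (A v)) h1
    simp only [LinearMap.sum_apply, LinearMap.smul_apply, map_sum, map_smul] at h2
    refine h2.symm.trans (Finset.sum_eq_zero fun i _ => ?_)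
    have h3 : α x (dualFamily (fun s => killing h hnd s x) (frobeniusMatrix a d x) i v) = 0 := hv i
    rw [h3, smul_zero]

theorem strongSymmetryOn {U : Set M} (hU : IsOpen U) {c : Fin n → ℝ}
    (hc : ∀ x ∈ U, (frobeniusMatrix a c x).det ≠ 0) (i j : Fin n) :
    StrongSymmetryOn U (constDualOps h hnd a c i) (constDualOps h hnd a c j) := by
  refine ⟨fun x _ => S.commute c c i j x, BracketVanishesOn.of_local fun x hx => ?_⟩
  -- A level near `x` supplies constants `d` whose dual operators are strong symmetries of each
  -- other. The transfer from `d` to `c` is made first in one slot, then in the other.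
  obtain ⟨V, hV, hxV, α, hα⟩ := exists_isRegularLevel S.smooth S.symm S.generic x
  refine ⟨U ∩ V, Set.inter_subset_left, ⟨hx, hxV⟩, ?_⟩
  have hUV := hU.inter hV
  have hα' : IsRegularLevel h (U ∩ V) α := ⟨hα.smooth.mono Set.inter_subset_right,
    fun s => (hα.level s).imp fun c hc x hx => hc x hx.2, fun x hx => hα.regular x hx.2⟩
  obtain ⟨d, hd⟩ := S.exists_levelMatrix_eq hα'
  have hc' : ∀ x ∈ U ∩ V, (frobeniusMatrix a c x).det ≠ 0 := fun x hx => hc x hx.1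
  have hd' : ∀ x ∈ U ∩ V, (frobeniusMatrix a d x).det ≠ 0 := fun x hx => (hd x hx).2.2
  have h1 : ∀ i j, StrongSymmetryOn (U ∩ V) (constDualOps h hnd a d i)
      (constDualOps h hnd a d j) := fun i j =>
    ⟨fun x _ => S.commute d d i j x, S.bracketVanishesOn_of_level hUV hα'
      (fun x hx => (hd x hx).1.symm.trans (hd x hx).2.1) hd' i j⟩
  have h2 : ∀ i j, StrongSymmetryOn (U ∩ V) (constDualOps h hnd a c i)
      (constDualOps h hnd a d j) := fun i j => by
    have h3 := S.strongSymmetryOn_of hUV hd' hc' (h1 j) i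
    exact ⟨fun x hx => (h3.1 x hx).symm, h3.2.swap h3.1⟩
  exact (S.strongSymmetryOn_of hUV hd' hc' (h2 i) j).2

theorem generatesSym {U : Set M} (hU : IsOpen U) {c : Fin n → ℝ}
    (hc : ∀ x ∈ U, (frobeniusMatrix a c x).det ≠ 0) : GeneratesSym U (constDualOps h hnd a c) where
  smooth := S.smoothOpOn hU hc
  strong := S.strongSymmetryOn hU hc
  cyclic x hx := by
    obtain ⟨q, hq⟩ := exists_regular_covector S.smooth S.symm S.generic x
    -- `K_s` maps this vector to `h s x q`, a basis, and `b⁻¹` carries that basis to another.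
    refine ⟨h 0 x q, ?_⟩
    convert linearIndependent_dualFamily hq (hc x hx) using 2 with i
    rw [constDualOps_apply, dualFamily, LinearMap.sum_apply]
    refine Finset.sum_congr rfl fun s _ => ?_
    rw [LinearMap.smul_apply]
    exact congrArg (fun v => _ • h s x v) ((S.killingData x).left_inv q)
  cocyclic x hx := by
    obtain ⟨q, hq⟩ := exists_regular_covector S.smooth S.symm S.generic x
    refine ⟨q, ?_⟩
    have h1 : (fun i => q ∘ₗ constDualOps h hnd a c i x) = fun i =>
        ∑ s, (frobeniusMatrix a c x)⁻¹ i s • (q ∘ₗ (h s x ∘ₗ lower h hnd x)) := by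
      ext i v
      simp only [constDualOps_apply, dualFamily, LinearMap.comp_apply, LinearMap.sum_apply,
        LinearMap.smul_apply, map_sum, map_smul]
      rfl
    rw [h1]
    exact linearIndependent_dualFamily ((S.killingData x).linearIndependent_comp hq) (hc x hx)

theorem sym_subset {U : Set M} (hU : IsOpen U) {c d : Fin n → ℝ}
    (hc : ∀ x ∈ U, (frobeniusMatrix a c x).det ≠ 0)
    (hd : ∀ x ∈ U, (frobeniusMatrix a d x).det ≠ 0) :
    Sym U (constDualOps h hnd a c) ⊆ Sym U (constDualOps h hnd a d) :=
  fun _ hN => ⟨hN.1, S.strongSymmetryOn_of hU hc hd hN.2⟩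

theorem isBasisOfSym {U : Set M} (hU : IsOpen U) {c : Fin n → ℝ}
    (hc : ∀ x ∈ U, (frobeniusMatrix a c x).det ≠ 0) :
    IsBasisOfSym U (Sym U (constDualOps h hnd a c)) (constDualOps h hnd a c) where
  mem i := ⟨S.smoothOpOn hU hc i, S.strongSymmetryOn hU hc i⟩
  indep x hx := linearIndependent_dualFamily (S.linearIndependent x) (hc x hx)
  span N hN := by
    obtain ⟨f, hf, hNf⟩ := exists_coefficients S.smooth S.symm S.generic S.comm hU hN.1
      fun x hx s => commute_killing_of_commute (hc x hx) (fun i => (hN.2 i).1 x hx) s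
    -- Substituting `K_s = ∑ b_si M^i` into the expansion of `N` in Killing tensors gives these
    -- coefficients.
    refine ⟨fun i x => ∑ s, f s x * frobeniusMatrix a c x s i, fun i => ?_, fun x hx => ?_⟩
    · rw [contMDiffOn_iff_charts hU]
      intro φ hφ
      exact ContDiffOn.sum fun s _ => ((contMDiffOn_iff_charts hU).1 (hf s) φ hφ).mul
        ((contMDiffOn_iff_charts hU).1 (S.contMDiff_frobeniusMatrix c s i).contMDiffOn φ hφ)
    · have h1 := sum_smul_dualFamily (fun s => killing h hnd s x) (hc x hx)
      rw [hNf x hx]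
      simp only [Finset.sum_smul, mul_smul]
      rw [Finset.sum_comm]
      refine Finset.sum_congr rfl fun s _ => ?_
      rw [← Finset.smul_sum]
      exact congrArg (fun A => f s x • A) (h1 s).symm

end KillingSystem

end KillingSystems

end OperatorFrobenius

end

/-! ### The main theorem -/

theorem mainTheorem8 {n : ℕ} [NeZero n] {M : Type*} [TopologicalSpace M]
    [ChartedSpace (EuclideanSpace ℝ (Fin n)) M] [IsManifold (𝓡 n) ∞ M]
    (h : Fin n → OperatorFrobenius.CoTensor n M)
    (hsmooth : ∀ s, OperatorFrobenius.SmoothCoTensor (h s))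
    (hsymm : ∀ s, OperatorFrobenius.SymmCoTensor (h s))
    (hpoisson : ∀ s t, OperatorFrobenius.PoissonCommute
      (OperatorFrobenius.quadFun (h s)) (OperatorFrobenius.quadFun (h t)))
    (hgeneric : OperatorFrobenius.GenericallyIndependent
      (fun s => OperatorFrobenius.quadFun (h s)))
    (hnd : OperatorFrobenius.FirstNondegenerate h)
    (hcomm : ∀ s t x, OperatorFrobenius.killing h hnd s x * OperatorFrobenius.killing h hnd t x =
      OperatorFrobenius.killing h hnd t x * OperatorFrobenius.killing h hnd s x) :
    -- near every point there is a regular common level surface, so that the `M^i` are available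
    (∀ x₀ : M, ∃ U : Set M, IsOpen U ∧ x₀ ∈ U ∧
      ∃ α : OperatorFrobenius.OneForm n M, OperatorFrobenius.IsRegularLevel h U α) ∧
    -- the structure functions `a i j s = a_{ij}^s` exist, are smooth and unique
    (∀ x, LinearIndependent ℝ fun s => OperatorFrobenius.killing h hnd s x) ∧
    ∃ a : Fin n → Fin n → Fin n → M → ℝ,
      (∀ i j s, ContMDiff (𝓡 n) 𝓘(ℝ, ℝ) ∞ (a i j s)) ∧
      (∀ i j x, OperatorFrobenius.killing h hnd i x * OperatorFrobenius.killing h hnd j x =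
        ∑ s, a i j s x • OperatorFrobenius.killing h hnd s x) ∧
      ∀ (c : Fin n → ℝ) (U : Set M), IsOpen U →
        (∀ x ∈ U, (OperatorFrobenius.frobeniusMatrix a c x).det ≠ 0) →
        ∀ Mbar : Fin n → OperatorFrobenius.OpField n M,
          Mbar = OperatorFrobenius.dualOps (OperatorFrobenius.killing h hnd)
            (OperatorFrobenius.frobeniusMatrix a c) →
          (∀ i, OperatorFrobenius.NijenhuisOn U (Mbar i)) ∧
          OperatorFrobenius.GeneratesSym U Mbar ∧
          ∀ α : OperatorFrobenius.OneForm n M, OperatorFrobenius.IsRegularLevel h U α →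
            ∀ Mop : Fin n → OperatorFrobenius.OpField n M,
              Mop = OperatorFrobenius.levelOps h hnd α →
              OperatorFrobenius.GeneratesSym U Mop ∧
              (∀ x ∈ U, IsUnit (∑ j, c j • Mop j x) ∧
                ∀ i, Mbar i x = Ring.inverse (∑ j, c j • Mop j x) * Mop i x) ∧
              OperatorFrobenius.Sym U Mbar = OperatorFrobenius.Sym U Mop ∧
              OperatorFrobenius.IsBasisOfSym U (OperatorFrobenius.Sym U Mop) Mbar := by
  refine ⟨fun x₀ => OperatorFrobenius.exists_isRegularLevel hsmooth hsymm hgeneric x₀,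
    OperatorFrobenius.linearIndependent_killing hsmooth hsymm hgeneric hcomm, ?_⟩
  obtain ⟨a, S⟩ := OperatorFrobenius.exists_killingSystem hsmooth hsymm hpoisson hgeneric hcomm
  refine ⟨a, S.smooth_structure, S.mul, ?_⟩
  rintro c U hU hc _ rfl
  refine ⟨fun i => (S.strongSymmetryOn hU hc i i).2, S.generatesSym hU hc, ?_⟩
  rintro α hα _ rfl
  obtain ⟨d, hd⟩ := S.exists_levelMatrix_eq hα
  have hd' : ∀ x ∈ U, (OperatorFrobenius.frobeniusMatrix a d x).det ≠ 0 :=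
    fun x hx => (hd x hx).2.2
  -- The level operators are the dual operators for the constants `d`, but only over `U`; hence the
  -- congruence lemmas.
  have hM : ∀ i, ∀ x ∈ U, OperatorFrobenius.levelOps h hnd α i x =
      OperatorFrobenius.constDualOps h hnd a d i x := by
    intro i x hx
    simp only [OperatorFrobenius.levelOps, OperatorFrobenius.dualOps, (hd x hx).1]
  have hSym : OperatorFrobenius.Sym U (OperatorFrobenius.constDualOps h hnd a c) =
      OperatorFrobenius.Sym U (OperatorFrobenius.levelOps h hnd α) :=
    (Set.Subset.antisymm (S.sym_subset hU hc hd') (S.sym_subset hU hd' hc)).trans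
      (OperatorFrobenius.Sym.congr hU hM).symm
  refine ⟨(S.generatesSym hU hd').congr hU hM, fun x hx => ?_, hSym, ?_⟩
  · have hP : ∑ j, c j • OperatorFrobenius.levelOps h hnd α j x =
        ∑ j, c j • OperatorFrobenius.constDualOps h hnd a d j x :=
      Finset.sum_congr rfl fun j _ => congrArg (c j • ·) (hM j x hx)
    -- The inverse is `∑ d_j M̄^j`, the same sum with the two functionals exchanged.
    have hunit : IsUnit (∑ j, c j • OperatorFrobenius.constDualOps h hnd a d j x) :=
      ⟨⟨_, _, S.sum_mul_sum (hc x hx) (hd' x hx), S.sum_mul_sum (hd' x hx) (hc x hx)⟩, rfl⟩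
    rw [hP]
    refine ⟨hunit, fun i => ?_⟩
    rw [hM i x hx, ← S.sum_mul (hc x hx) (hd' x hx) i, Ring.inverse_mul_cancel_left _ _ hunit]
  · rw [← hSym]
    exact S.isBasisOfSym hU hc
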